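/- **Theorem 1.** For $1\le p\le\infty$ and a $2\pi$-periodic function $f$ let $\|f\|_p$ be its norm in $L_p$ over one period: $\|f\|_p=\big(\int_0^{2\pi}|f(t)|^p\,dt\big)^{1/p}$ for $p<\infty$, and $\|f\|_\infty=\operatorname{ess\,sup}_t|f(t)|$. For $\alpha>0$, $r>0$, $\beta\in\mathbb R$ put $$P_{\alpha,r,\beta}(t)=\sum_{k=1}^{\infty}e^{-\alpha k^r}\cos\Big(kt-\frac{\beta\pi}{2}\Big),$$ and let $C^{\alpha,r}_{\beta,1}$ be the set of all $2\pi$-periodic functions $f$ that can be written, for all $x\in\mathbb R$, as $$f(x)=\frac{a_0}{2}+\frac1\pi\int_{-\pi}^{\pi}P_{\alpha,r,\beta}(x-t)\varphi(t)\,dt$$ with some $a_0\in\mathbb R$ and some $2\pi$-periodic $\varphi\in L_1$ such that $\|\varphi\|_1\le1$ and $\int_{-\pi}^{\pi}\varphi(t)\,dt=0$. Let $$\mathcal E_n(C^{\alpha,r}_{\beta,1})_s=\sup_{f\in C^{\alpha,r}_{\beta,1}}\|f-S_{n-1}(f;\cdot)\|_s,$$ where $S_{n-1}(f;\cdot)$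 is the partial Fourier sum of order $n-1$ of $f$. For $v>0$ let $\mathcal J_s(v)$ be the norm of the function $t\mapsto(t^2+1)^{-1/2}$ in $L_s[0,v]$ (with respect to Lebesgue measure). For $\alpha>0$, $0<r<1$, $1\le p\le\infty$ let $n_0(\alpha,r,p)$ be the least positive integer $n$ such that $$\frac{1}{\alpha r}\frac1{n^r}+\frac{\alpha r\,\chi(p)}{n^{1-r}}\le\begin{cases}\frac1{14},&p=1,\\ \frac1{(3\pi)^3}\cdot\frac{p-1}{p},&1<p<\infty,\\ \frac1{(3\pi)^3},&p=\infty,\end{cases}$$ where $\chi(p)=p$ for $1\le p<\infty$ and $\chi(\infty)=1$. Let $0<r<1$, $1\le s\le\infty$, $\frac1s+\frac1{s'}=1$, $\alpha>0$ and $\beta\in\mathbb R$. Then for every integer $n\ge n_0(\alpha,r,s')$ the quantity $\mathcal E_n(C^{\alpha,r}_{\beta,1})_s$ is finite and $$\mathcal E_n(C^{\alpha,r}_{\beta,1})_s=e^{-\alpha n^r}n^{\frac{1-r}{s'}}\left(\frac{\|\cos t\|_s}{\pi^{1+\frac1s}(\alpha r)^{\frac1{s'}}}\,\mathcal J_s\Big(\frac{\pi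 n^{1-r}}{\alpha r}\Big)+\gamma\left(\frac{1}{(\alpha r)^{1+\frac1{s'}}}\,\mathcal J_s\Big(\frac{\pi n^{1-r}}{\alpha r}\Big)\frac1{n^r}+\frac1{n^{\frac{1-r}{s'}}}\right)\right)$$ for some real number $\gamma=\gamma_{n,s}(\alpha,r,\beta)$ with $|\gamma|\le(14\pi)^2$. -/

import Mathlib

open Real MeasureTheory
open scoped ENNReal

noncomputable section

namespace GenPoisson

/-- The norm of `L_p` of `2π`-periodic functions: the `L_p` norm over one period `[0, 2π)`. -/
def periodNorm (f : ℝ → ℝ) (p : ℝ≥0∞) : ℝ≥0∞ :=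
  eLpNorm f p (volume.restrict (Set.Ico 0 (2 * π)))

/-- The generalized Poisson kernel `∑_{k ≥ 1} exp (-α k ^ r) cos (k t - β π / 2)`. -/
def poissonKernel (α r β t : ℝ) : ℝ :=
  ∑' k : ℕ, exp (-α * ((k + 1 : ℕ) : ℝ) ^ r) * cos (((k + 1 : ℕ) : ℝ) * t - β * π / 2)

/-- `B_p^0`: the `2π`-periodic functions `φ ∈ L_p` with `‖φ‖_p ≤ 1` and mean value zero. -/
def unitBallZeroMean (p : ℝ≥0∞) : Set (ℝ → ℝ) :=
  {φ | Function.Periodic φ (2 * π) ∧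
    AEStronglyMeasurable φ (volume.restrict (Set.Ico 0 (2 * π))) ∧
    periodNorm φ p ≤ 1 ∧ ∫ t in (-π)..π, φ t = 0}

/-- The class `C^{α,r}_{β,p}` of generalized Poisson integrals of functions from `B_p^0`. -/
def poissonClass (α r β : ℝ) (p : ℝ≥0∞) : Set (ℝ → ℝ) :=
  {f | Function.Periodic f (2 * π) ∧ ∃ a₀ : ℝ, ∃ φ ∈ unitBallZeroMean p, ∀ x : ℝ,
    f x = a₀ / 2 + 1 / π * ∫ t in (-π)..π, poissonKernel α r β (x - t) * φ t}

/-- The Fourier coefficient `a_k (f)`. -/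
def cosCoeff (f : ℝ → ℝ) (k : ℕ) : ℝ := 1 / π * ∫ t in (-π)..π, f t * cos (k * t)

/-- The Fourier coefficient `b_k (f)`. -/
def sinCoeff (f : ℝ → ℝ) (k : ℕ) : ℝ := 1 / π * ∫ t in (-π)..π, f t * sin (k * t)

/-- The partial Fourier sum `S_m (f; x)` of order `m`. -/
def fourierSum (m : ℕ) (f : ℝ → ℝ) (x : ℝ) : ℝ :=
  cosCoeff f 0 / 2 +
    ∑ k ∈ Finset.Icc 1 m, (cosCoeff f k * cos (k * x) + sinCoeff f k * sin (k * x))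

/-- `𝓔_n (C^{α,r}_{β,p})_s`, the supremum over the class of `‖f - S_{n-1} (f)‖_s`. -/
def fourierError (n : ℕ) (α r β : ℝ) (p s : ℝ≥0∞) : ℝ≥0∞ :=
  ⨆ f ∈ poissonClass α r β p, periodNorm (fun x => f x - fourierSum (n - 1) f x) s

/-- `χ (p) = p` for finite `p`, and `χ (∞) = 1`. -/
def chi (p : ℝ≥0∞) : ℝ := if p = ∞ then 1 else p.toReal

/-- The right-hand side of the inequality that defines `n₀`. -/
def threshold (p : ℝ≥0∞) : ℝ :=
  if p = 1 then 1 / 14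
  else if p = ∞ then 1 / (3 * π) ^ 3
  else 1 / (3 * π) ^ 3 * ((p.toReal - 1) / p.toReal)

/-- `n₀ (α, r, p)`: the least positive integer `n` with
`1 / (α r n ^ r) + α r χ (p) / n ^ (1 - r) ≤ threshold p`. -/
def n₀ (α r : ℝ) (p : ℝ≥0∞) : ℕ :=
  sInf {n : ℕ | 1 ≤ n ∧
    1 / (α * r) * (1 / (n : ℝ) ^ r) + α * r * chi p / (n : ℝ) ^ (1 - r) ≤ threshold p}

/-- `𝓙_s (v)`, the norm of `1 / √(t² + 1)` in `L_s[0, v]`. -/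
def J (s : ℝ≥0∞) (v : ℝ) : ℝ :=
  (eLpNorm (fun t : ℝ => 1 / √(t ^ 2 + 1)) s (volume.restrict (Set.Icc 0 v))).toReal

end GenPoisson

end

noncomputable section

namespace GenPoisson

/-! Put δ = αr/n^(1-r) and ε = 1/(αr n^r), so that 1/n = δε; the condition n ≥ n₀ gives ε + δ ≤
1/14. The remainder f - S_{n-1}(f) is the convolution of φ with K(t) = (1/π) ∑_{k≥n} e^{-αk^r}
cos(kt - βπ/2) (`sub_fourierSum_eq`). Young's inequality bounds the error by ‖K‖_s
(`fourierError_le`). Conversely, bumps of mass 1/2 and opposite signs at 0 and π/n give the lower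
bound ½‖K - K(· - π/n)‖_s (`le_fourierError`). Now K = (e^{-αn^r}/π) Re(e^{i(nt - βπ/2)} F(t)) with
F slowly varying on the scale 1/n. Translation by π/n reverses the sign of the carrier, so K(· -
π/n) ≈ -K and the two bounds agree up to an admissible error.

The amplitude F is compared with u(t) = 1/(1 - q e^{it}), q = e^{-δ}. Its coefficients satisfy q l_k
≤ l_{k+1}, hence (1 - qz)F - 1 has nonnegative coefficients and is bounded by its value at z = 1,
which is at most δ + 3ε. As δ|u| ≤ 2, this gives |F - u| ≤ 3ε|u| + 2 (`norm_tailSeries_sub_le`).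

Over a distance 2π/n the function u has relative variation O(ε). Changing the phase θ in
Re(e^{i(nt+θ)} u) is therefore a translation up to a small relative error, and the norm is almost
independent of θ. It may be replaced by its mean over θ, which Tonelli's theorem evaluates exactly
as (2π)^{-1/s} ‖cos‖_s ‖u‖_s (`abs_periodNorm_modulated_sub_le`). Finally |u| is within 2 of (t² +
δ²)^{-1/2} on [-π, π], and the dilation t = δx produces 2^{1/s} δ^{1/s-1} 𝓙_s(π/δ)
(`abs_periodNorm_geomKernel_sub_le`). -/

/-- Lebesgue measure on one period. -/
abbrev periodMeasure : Measure ℝ := volume.restrict (Set.Ico 0 (2 * π))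

/-! ### Norms over one period. -/

/-- Each side is the norm of the induced function on the circle, where the choice of the base point
disappears. -/
theorem eLpNorm_restrict_Ioc_of_periodic {f : ℝ → ℝ} (hf : Continuous f)
    (hp : Function.Periodic f (2 * π)) (a : ℝ) (s : ℝ≥0∞) :
    eLpNorm f s (volume.restrict (Set.Ioc a (a + 2 * π))) = periodNorm f s := by
  have : Fact (0 < 2 * π) := ⟨two_pi_pos⟩
  have key : ∀ a : ℝ, eLpNorm f s (volume.restrict (Set.Ioc a (a + 2 * π))) =
      eLpNorm (hp.lift : AddCircle (2 * π) → ℝ) s volume := by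
    intro a
    have hG : Continuous (hp.lift : AddCircle (2 * π) → ℝ) :=
      continuous_coinduced_dom.mpr hf
    rw [← eLpNorm_comp_measurePreserving hG.aestronglyMeasurable
      (AddCircle.measurePreserving_mk (2 * π) a)]
    rfl
  rw [key a, ← key 0, periodNorm, restrict_Ico_eq_restrict_Ioc, zero_add]

theorem periodNorm_comp_add {f : ℝ → ℝ} (hf : Continuous f)
    (hp : Function.Periodic f (2 * π)) (h : ℝ) (s : ℝ≥0∞) :
    periodNorm (fun t => f (t + h)) s = periodNorm f s := by
  have h1 : MeasurePreserving (fun t : ℝ => t + h) (volume.restrict (Set.Ioc 0 (2 * π)))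
      (volume.restrict (Set.Ioc h (h + 2 * π))) := by
    have := (measurePreserving_add_right (volume : Measure ℝ) h).restrict_preimage
      (s := Set.Ioc h (h + 2 * π)) measurableSet_Ioc
    simpa using this
  rw [← eLpNorm_restrict_Ioc_of_periodic hf hp h, ← eLpNorm_comp_measurePreserving
    hf.aestronglyMeasurable h1, periodNorm, restrict_Ico_eq_restrict_Ioc]
  rfl

/-- The set where the essential supremum is exceeded is open and locally null, hence locally empty.
This gives the pointwise bounds needed for s = ∞. -/
theorem enorm_le_periodNorm_top {f : ℝ → ℝ} (hf : Continuous f)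
    (hp : Function.Periodic f (2 * π)) (t : ℝ) : ‖f t‖ₑ ≤ periodNorm f ∞ := by
  by_contra! hlt
  set c := periodNorm f ∞ with hc
  have h1 : ∀ᵐ x ∂(volume.restrict (Set.Ioc (t - π) (t - π + 2 * π))), ‖f x‖ₑ ≤ c := by
    rw [hc, ← eLpNorm_restrict_Ioc_of_periodic hf hp (t - π)]
    exact ae_le_eLpNormEssSup
  rw [ae_restrict_iff' measurableSet_Ioc] at h1
  have hU : IsOpen ({x | c < ‖f x‖ₑ} ∩ Set.Ioo (t - π) (t + π)) :=
    (isOpen_lt continuous_const hf.enorm).inter isOpen_Ioo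
  have h0 : volume ({x | c < ‖f x‖ₑ} ∩ Set.Ioo (t - π) (t + π)) = 0 := by
    refine measure_mono_null ?_ h1
    rintro x ⟨hx1, hx2, hx3⟩ hx
    exact not_le.mpr hx1 (hx ⟨hx2, by linarith⟩)
  have ht : t ∈ {x | c < ‖f x‖ₑ} ∩ Set.Ioo (t - π) (t + π) :=
    ⟨hlt, by linarith [pi_pos], by linarith [pi_pos]⟩
  rw [(hU.measure_eq_zero_iff volume).mp h0] at ht
  exact ht

theorem periodNorm_le_add {f g h : ℝ → ℝ} (hg : Continuous g) (hh : Continuous h)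
    {s : ℝ≥0∞} (hs : 1 ≤ s) (hle : ∀ t, |f t| ≤ |g t| + |h t|) :
    periodNorm f s ≤ periodNorm g s + periodNorm h s := by
  calc periodNorm f s ≤ periodNorm ((fun t => ‖g t‖) + (fun t => ‖h t‖)) s := by
        refine eLpNorm_mono fun t => ?_
        simp only [Pi.add_apply, Real.norm_eq_abs]
        exact (hle t).trans (le_abs_self _)
    _ ≤ periodNorm (fun t => ‖g t‖) s + periodNorm (fun t => ‖h t‖) s :=
        eLpNorm_add_le hg.norm.aestronglyMeasurable hh.norm.aestronglyMeasurable hs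
    _ = _ := by simp only [periodNorm, eLpNorm_norm]

theorem periodNorm_ne_top {f : ℝ → ℝ} (hf : Continuous f) (s : ℝ≥0∞) :
    periodNorm f s ≠ ∞ := by
  obtain ⟨C, hC⟩ := (isCompact_Icc (a := (0 : ℝ)) (b := 2 * π)).exists_bound_of_continuousOn
    hf.continuousOn
  refine (MemLp.of_bound (p := s) hf.aestronglyMeasurable C ?_).2.ne
  filter_upwards [ae_restrict_mem measurableSet_Ico] with t ht
  exact hC t (Set.Ico_subset_Icc_self ht)

/-- The norm is (2π)^(1/s) c, and 2π ≥ 1 with 1/s ≤ 1; the bound is uniform in s. -/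
theorem periodNorm_const_le {s : ℝ≥0∞} (hs : 1 ≤ s) {c : ℝ} (hc : 0 ≤ c) :
    (periodNorm (fun _ => c) s).toReal ≤ 2 * π * c := by
  have h0 : s ≠ 0 := (zero_lt_one.trans_le hs).ne'
  have hpi : 1 ≤ 2 * π := by linarith [pi_gt_three]
  have h1 : 1 / s.toReal ≤ 1 := by
    rcases eq_or_ne s ∞ with rfl | hst
    · simp
    · rw [div_le_one (ENNReal.toReal_pos h0 hst)]
      · have := (ENNReal.toReal_le_toReal ENNReal.one_ne_top hst).mpr hs
        simpa using this
  rw [periodNorm, eLpNorm_const _ h0 (by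
    rw [Ne, Measure.restrict_eq_zero]; simp [Real.volume_Ico, pi_pos])]
  rw [Measure.restrict_apply_univ, Real.volume_Ico, sub_zero, ENNReal.toReal_mul,
    ← ENNReal.toReal_rpow, ENNReal.toReal_ofReal two_pi_pos.le, toReal_enorm,
    Real.norm_of_nonneg hc, mul_comm]
  refine mul_le_mul_of_nonneg_right ?_ hc
  calc (2 * π) ^ (1 / s.toReal) ≤ (2 * π) ^ (1 : ℝ) := rpow_le_rpow_of_exponent_le hpi h1
    _ = _ := rpow_one _

theorem periodNorm_const_mul (c : ℝ) (f : ℝ → ℝ) (s : ℝ≥0∞) :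
    (periodNorm (fun t => c * f t) s).toReal = |c| * (periodNorm f s).toReal := by
  have : periodNorm (fun t => c * f t) s = ‖c‖ₑ * periodNorm f s :=
    eLpNorm_const_smul c f s _
  rw [this, ENNReal.toReal_mul, toReal_enorm, Real.norm_eq_abs]

theorem periodNorm_toReal_le_add {f g h : ℝ → ℝ} (hg : Continuous g)
    (hh : Continuous h) {s : ℝ≥0∞} (hs : 1 ≤ s) (hle : ∀ t, |f t| ≤ |g t| + |h t|) :
    (periodNorm f s).toReal ≤ (periodNorm g s).toReal + (periodNorm h s).toReal := by
  rw [← ENNReal.toReal_add (periodNorm_ne_top hg s) (periodNorm_ne_top hh s)]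
  exact ENNReal.toReal_mono
    (ENNReal.add_ne_top.mpr ⟨periodNorm_ne_top hg s, periodNorm_ne_top hh s⟩)
    (periodNorm_le_add hg hh hs hle)

/-- A perturbation bounded by `a * |g| + c` changes the norm by at most `a * ‖g‖ + 2πc`. -/
theorem periodNorm_toReal_le_of_abs_le {f₁ f₂ g : ℝ → ℝ} (h₂ : Continuous f₂)
    (hg : Continuous g) {s : ℝ≥0∞} (hs : 1 ≤ s) {a c : ℝ} (ha : 0 ≤ a) (hc : 0 ≤ c)
    (hle : ∀ t, |f₁ t| ≤ |f₂ t| + (a * |g t| + c)) :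
    (periodNorm f₁ s).toReal ≤
      (periodNorm f₂ s).toReal + (a * (periodNorm g s).toReal + 2 * π * c) := by
  have e1 : (periodNorm (fun t => a * |g t|) s).toReal = a * (periodNorm g s).toReal := by
    rw [periodNorm_const_mul, abs_of_nonneg ha]
    congr 2
    exact eLpNorm_norm g
  have c1 : Continuous fun t => a * |g t| := by fun_prop
  have c2 : Continuous fun _ : ℝ => c := continuous_const
  have i1 := periodNorm_toReal_le_add (f := f₁) h₂ (c1.add c2) hs (fun t =>
    (hle t).trans (by gcongr; exact le_abs_self _))
  have i2 := periodNorm_toReal_le_add (f := (fun t => a * |g t|) + fun _ => c) c1 c2 hs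
    (fun t => abs_add_le _ _)
  have i3 := periodNorm_const_le hs hc
  linarith

theorem periodic_intervalIntegral_eq {f : ℝ → ℝ} (hf : Function.Periodic f (2 * π)) :
    ∫ t in (-π)..π, f t = ∫ t, f t ∂periodMeasure := by
  have := hf.intervalIntegral_add_eq (-π) 0
  rw [show -π + 2 * π = π by ring, zero_add] at this
  rw [this, intervalIntegral.integral_of_le two_pi_pos.le, periodMeasure,
    restrict_Ico_eq_restrict_Ioc]

theorem periodic_sub_left {f : ℝ → ℝ} (hf : Function.Periodic f (2 * π)) (x : ℝ) :
    Function.Periodic (fun t => f (x - t)) (2 * π) := fun t => by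
  simp only
  rw [← hf (x - (t + 2 * π))]
  congr 1
  ring

/-! ### Young's inequality. -/

theorem periodNorm_one_lintegral (φ : ℝ → ℝ) :
    periodNorm φ 1 = ∫⁻ t, ‖φ t‖ₑ ∂periodMeasure := eLpNorm_one_eq_lintegral_enorm

/-- Young's inequality for the convolution of a continuous function with an element of the unit
ball of `L_1`. -/
theorem periodNorm_convolution_le {P φ : ℝ → ℝ} (hP : Continuous P)
    (hp : Function.Periodic P (2 * π)) (hφm : AEStronglyMeasurable φ periodMeasure)
    (hφ : periodNorm φ 1 ≤ 1) {s : ℝ≥0∞} (hs : 1 ≤ s) :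
    periodNorm (fun x => ∫ t, P (x - t) * φ t ∂periodMeasure) s ≤ periodNorm P s := by
  have h0 : s ≠ 0 := (zero_lt_one.trans_le hs).ne'
  rw [periodNorm_one_lintegral] at hφ
  -- The weight |φ| dt has mass at most 1, so the L_1(ν) norm is at most the L_s(ν) norm. Tonelli's
  -- theorem and translation invariance then finish the case s < ∞.
  set ν : Measure ℝ := periodMeasure.withDensity (fun t => ‖φ t‖ₑ) with hν
  have hνu : ν Set.univ ≤ 1 := by rw [hν, withDensity_apply _ MeasurableSet.univ]; simpa using hφ
  have hb : ∀ x, ‖∫ t, P (x - t) * φ t ∂periodMeasure‖ₑ ≤ eLpNorm (fun t => P (x - t)) s ν := by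
    intro x
    have c1 : Continuous fun t => P (x - t) := by fun_prop
    calc ‖∫ t, P (x - t) * φ t ∂periodMeasure‖ₑ
        ≤ ∫⁻ t, ‖P (x - t) * φ t‖ₑ ∂periodMeasure := enorm_integral_le_lintegral_enorm _
      _ = ∫⁻ t, ‖P (x - t)‖ₑ ∂ν := by
          rw [hν, lintegral_withDensity_eq_lintegral_mul₀ hφm.enorm c1.enorm.aemeasurable]
          refine lintegral_congr fun t => ?_
          simp [enorm_mul, mul_comm]
      _ = eLpNorm (fun t => P (x - t)) 1 ν := eLpNorm_one_eq_lintegral_enorm.symm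
      _ ≤ eLpNorm (fun t => P (x - t)) s ν * ν Set.univ ^ (1 / (1 : ℝ≥0∞).toReal - 1 / s.toReal) :=
          eLpNorm_le_eLpNorm_mul_rpow_measure_univ hs c1.aestronglyMeasurable
      _ ≤ eLpNorm (fun t => P (x - t)) s ν * 1 := by
          gcongr
          refine ENNReal.rpow_le_one hνu ?_
          rcases eq_or_ne s ∞ with rfl | hst
          · simp
          · have := (ENNReal.toReal_le_toReal ENNReal.one_ne_top hst).mpr hs
            simp only [ENNReal.toReal_one] at this ⊢
            rw [sub_nonneg]
            exact one_div_le_one_div_of_le one_pos this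
      _ = _ := mul_one _
  rcases eq_or_ne s ∞ with rfl | hst
  · have hP' : ∀ t, ‖P t‖ₑ ≤ periodNorm P ∞ :=
      enorm_le_periodNorm_top hP hp
    refine (eLpNorm_exponent_top (f := _)).trans_le (eLpNormEssSup_le_of_ae_enorm_bound ?_)
    refine Filter.Eventually.of_forall fun x => (hb x).trans ?_
    exact eLpNormEssSup_le_of_ae_enorm_bound (Filter.Eventually.of_forall fun t => hP' _)
  · have hp0 := ENNReal.toReal_pos h0 hst
    have : SFinite ν := by rw [hν]; infer_instance
    have hmeas : Measurable (Function.uncurry fun x t => ‖P (x - t)‖ₑ ^ s.toReal) := by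
      have : Continuous (Function.uncurry fun x t : ℝ => P (x - t)) :=
        hP.comp (continuous_fst.sub continuous_snd)
      exact (this.measurable.enorm).pow_const _
    have key : periodNorm (fun x => ∫ t, P (x - t) * φ t ∂periodMeasure) s ^ s.toReal ≤
        periodNorm P s ^ s.toReal := by
      rw [periodNorm, eLpNorm_eq_lintegral_rpow_enorm_toReal h0 hst, ← ENNReal.rpow_mul,
        one_div, inv_mul_cancel₀ hp0.ne', ENNReal.rpow_one]
      calc ∫⁻ x, ‖∫ t, P (x - t) * φ t ∂periodMeasure‖ₑ ^ s.toReal ∂periodMeasure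
          ≤ ∫⁻ x, ∫⁻ t, ‖P (x - t)‖ₑ ^ s.toReal ∂ν ∂periodMeasure := by
            refine lintegral_mono fun x => ?_
            refine (ENNReal.rpow_le_rpow (hb x) hp0.le).trans_eq ?_
            rw [eLpNorm_eq_lintegral_rpow_enorm_toReal h0 hst, ← ENNReal.rpow_mul,
              one_div, inv_mul_cancel₀ hp0.ne', ENNReal.rpow_one]
        _ = ∫⁻ t, ∫⁻ x, ‖P (x - t)‖ₑ ^ s.toReal ∂periodMeasure ∂ν :=
            lintegral_lintegral_swap hmeas.aemeasurable
        _ = ∫⁻ _t, periodNorm P s ^ s.toReal ∂ν := by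
            refine lintegral_congr fun t => ?_
            rw [← periodNorm_comp_add hP hp (-t), periodNorm,
              eLpNorm_eq_lintegral_rpow_enorm_toReal h0 hst, ← ENNReal.rpow_mul,
              one_div, inv_mul_cancel₀ hp0.ne', ENNReal.rpow_one]
            rfl
        _ ≤ periodNorm P s ^ s.toReal := by
            rw [lintegral_const]
            exact mul_le_of_le_one_right' hνu
    exact (ENNReal.rpow_le_rpow_iff hp0).mp key

theorem periodic_uniformContinuous {P : ℝ → ℝ} (hP : Continuous P)
    (hp : Function.Periodic P (2 * π)) : UniformContinuous P := by
  have : Fact (0 < 2 * π) := ⟨two_pi_pos⟩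
  have hG : Continuous (hp.lift : AddCircle (2 * π) → ℝ) := continuous_coinduced_dom.mpr hP
  have h1 := CompactSpace.uniformContinuous_of_continuous hG
  have h2 : UniformContinuous (fun t : ℝ => (t : AddCircle (2 * π))) := by
    exact uniformContinuous_of_continuousAt_zero
      (QuotientAddGroup.mk' (AddSubgroup.zmultiples (2 * π)))
      (AddCircle.continuous_mk' (2 * π)).continuousAt
  exact h1.comp h2

/-! ### Modulated functions and averaging over the phase. -/

/-- The real part of `exp (i (n t + θ)) u (t)`. -/
def modulated (n : ℕ) (u : ℝ → ℂ) (θ t : ℝ) : ℝ :=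
  (Complex.exp (((n * t + θ : ℝ) : ℂ) * Complex.I) * u t).re

theorem modulated_eq (n : ℕ) (u : ℝ → ℂ) (θ t : ℝ) :
    modulated n u θ t = ‖u t‖ * cos (n * t + θ + (u t).arg) := by
  rw [modulated]
  conv_lhs => rw [← Complex.norm_mul_exp_arg_mul_I (u t)]
  rw [mul_left_comm, ← Complex.exp_add, ← add_mul, ← Complex.ofReal_add, Complex.re_ofReal_mul,
    Complex.exp_ofReal_mul_I_re]

theorem abs_modulated_le (n : ℕ) (u : ℝ → ℂ) (θ t : ℝ) : |modulated n u θ t| ≤ ‖u t‖ := by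
  rw [modulated_eq, abs_mul, abs_norm]
  exact mul_le_of_le_one_right (norm_nonneg _) (abs_cos_le_one _)

theorem continuous_modulated (n : ℕ) {u : ℝ → ℂ} (hu : Continuous u) (θ : ℝ) :
    Continuous (modulated n u θ) := by
  unfold modulated
  fun_prop

theorem modulated_periodic (n : ℕ) {u : ℝ → ℂ} (hu : Function.Periodic u (2 * π)) (θ : ℝ) :
    Function.Periodic (modulated n u θ) (2 * π) := fun t => by
  rw [modulated_eq, modulated_eq, hu t]
  congr 1
  rw [show (n : ℝ) * (t + 2 * π) + θ + (u t).arg = n * t + θ + (u t).arg + n * (2 * π) by ring]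
  exact cos_add_nat_mul_two_pi _ _

theorem modulated_sub (n : ℕ) (u v : ℝ → ℂ) (θ t : ℝ) :
    modulated n u θ t - modulated n v θ t = modulated n (fun x => u x - v x) θ t := by
  simp [modulated, mul_sub]

theorem periodNorm_rpow {s : ℝ≥0∞} (hs : 1 ≤ s) (hst : s ≠ ∞) (f : ℝ → ℝ) :
    periodNorm f s ^ s.toReal = ∫⁻ t, ‖f t‖ₑ ^ s.toReal ∂periodMeasure := by
  have h0 : s ≠ 0 := (zero_lt_one.trans_le hs).ne'
  rw [periodNorm, eLpNorm_eq_lintegral_rpow_enorm_toReal h0 hst, ← ENNReal.rpow_mul,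
      one_div, inv_mul_cancel₀ (ENNReal.toReal_pos h0 hst).ne', ENNReal.rpow_one]

/-- The average over the phase of the norms of the modulated function. -/
theorem lintegral_periodNorm_modulated (n : ℕ) {u : ℝ → ℂ} (hu : Continuous u) {s : ℝ≥0∞}
    (hs : 1 ≤ s) (hst : s ≠ ∞) :
    ∫⁻ θ, periodNorm (modulated n u θ) s ^ s.toReal ∂periodMeasure =
      periodNorm cos s ^ s.toReal * periodNorm (fun t => ‖u t‖) s ^ s.toReal := by
  have hmeas : Measurable (Function.uncurry fun θ t => ‖modulated n u θ t‖ₑ ^ s.toReal) := by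
    have : Continuous (Function.uncurry fun θ t : ℝ => modulated n u θ t) := by
      unfold modulated Function.uncurry
      fun_prop
    exact (this.measurable.enorm).pow_const _
  simp_rw [periodNorm_rpow hs hst]
  rw [lintegral_lintegral_swap hmeas.aemeasurable, ← lintegral_const_mul _
    (hu.norm.measurable.enorm.pow_const _)]
  refine lintegral_congr fun t => ?_
  -- For fixed t the integral over θ is a full-period integral of a translate of |cos|^s, so it does
  -- not depend on n, t or the argument of u.
  have h1 := periodNorm_rpow hs hst (fun θ => cos (θ + (n * t + (u t).arg)))
  rw [periodNorm_comp_add continuous_cos cos_periodic, periodNorm_rpow hs hst] at h1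
  rw [h1, ← lintegral_mul_const]
  · refine lintegral_congr fun θ => ?_
    rw [modulated_eq, enorm_mul, ENNReal.mul_rpow_of_nonneg _ _ ENNReal.toReal_nonneg, mul_comm,
      show (n : ℝ) * t + θ + (u t).arg = θ + (n * t + (u t).arg) by ring]
  · have : Continuous fun θ => cos (θ + (n * t + (u t).arg)) := by fun_prop
    exact this.measurable.enorm.pow_const _

/-- Change of phase is almost a translation. -/
theorem periodNorm_modulated_le {n : ℕ} (hn : 1 ≤ n) {u : ℝ → ℂ} (hu : Continuous u)
    (hp : Function.Periodic u (2 * π)) {a : ℝ}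
    (hau : ∀ t h, 0 ≤ h → h ≤ 2 * π / n → ‖u (t + h) - u t‖ ≤ a * ‖u t‖) {s : ℝ≥0∞}
    (hs : 1 ≤ s) (θ θ' : ℝ) :
    periodNorm (modulated n u θ') s ≤
      periodNorm (modulated n u θ) s + periodNorm (fun t => a * ‖u t‖) s := by
  have hn' : (0 : ℝ) < n := by exact_mod_cast hn
  -- The phase difference reduced modulo 2π to [0, 2π). Translating by y/n then reproduces it in the
  -- carrier, and y/n ≤ 2π/n is small enough for the variation of u.
  set y := toIcoMod two_pi_pos 0 (θ' - θ) with hy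
  have hy0 := toIcoMod_mem_Ico two_pi_pos 0 (θ' - θ)
  rw [← hy, zero_add] at hy0
  have hyz : θ' = y + θ + toIcoDiv two_pi_pos 0 (θ' - θ) * (2 * π) := by
    have := toIcoMod_add_toIcoDiv_zsmul two_pi_pos 0 (θ' - θ)
    rw [zsmul_eq_mul] at this
    rw [hy]
    linarith
  rw [← periodNorm_comp_add (continuous_modulated n hu θ) (modulated_periodic n hp θ) (y / n)]
  refine periodNorm_le_add ?_ ?_ hs fun t => ?_
  · exact (continuous_modulated n hu θ).comp (continuous_id.add continuous_const)
  · fun_prop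
  have e1 : modulated n u θ (t + y / n) = modulated n (fun x => u (x + y / n)) θ' t := by
    rw [modulated_eq, modulated_eq, hyz]
    congr 1
    rw [show (n : ℝ) * t + (y + θ + (toIcoDiv two_pi_pos 0 (θ' - θ) : ℝ) * (2 * π)) +
      (u (t + y / n)).arg = (n * t + y + θ + (u (t + y / n)).arg) +
        (toIcoDiv two_pi_pos 0 (θ' - θ) : ℝ) * (2 * π) by ring, cos_add_int_mul_two_pi]
    congr 1
    field_simp
  have e2 : |modulated n u θ' t - modulated n u θ (t + y / n)| ≤ a * ‖u t‖ := by
    rw [e1, modulated_sub]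
    refine (abs_modulated_le _ _ _ _).trans ?_
    rw [norm_sub_rev]
    exact hau t _ (by have := hy0.1; positivity) (by have := hy0.2; gcongr)
  calc |modulated n u θ' t|
      ≤ |modulated n u θ (t + y / n)| + |modulated n u θ' t - modulated n u θ (t + y / n)| := by
        have := abs_add_le (modulated n u θ (t + y / n))
          (modulated n u θ' t - modulated n u θ (t + y / n))
        simpa using this
    _ ≤ _ := by
        exact add_le_add_right (e2.trans (le_abs_self _)) _

theorem toReal_one_div_of_one_le (s : ℝ≥0∞) : (1 / s).toReal = 1 / s.toReal := by
  simp

/-- Averaging: `‖Re (exp (i (n t + θ)) u)‖ ≈ (2π)^{-1/s} ‖cos‖ ‖u‖` for slowly varying `u`. -/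
theorem abs_periodNorm_modulated_sub_le {n : ℕ} (hn : 1 ≤ n) {u : ℝ → ℂ} (hu : Continuous u)
    (hp : Function.Periodic u (2 * π)) {a : ℝ} (ha : 0 ≤ a)
    (hau : ∀ t h, 0 ≤ h → h ≤ 2 * π / n → ‖u (t + h) - u t‖ ≤ a * ‖u t‖) {s : ℝ≥0∞}
    (hs : 1 ≤ s) (θ : ℝ) :
    |(periodNorm (modulated n u θ) s).toReal -
        (periodNorm cos s).toReal / (2 * π) ^ (1 / s).toReal *
          (periodNorm (fun t => ‖u t‖) s).toReal| ≤
      a * (periodNorm (fun t => ‖u t‖) s).toReal := by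
  have hae : (periodNorm (fun t => a * ‖u t‖) s).toReal =
      a * (periodNorm (fun t => ‖u t‖) s).toReal := by
    rw [periodNorm_const_mul, abs_of_nonneg ha]
  set e := periodNorm (fun t => a * ‖u t‖) s with he
  set U := periodNorm (fun t => ‖u t‖) s with hU
  have hUt : U ≠ ∞ := periodNorm_ne_top hu.norm s
  have het : e ≠ ∞ := periodNorm_ne_top (by fun_prop) s
  have hNt : ∀ θ, periodNorm (modulated n u θ) s ≠ ∞ := fun θ =>
    periodNorm_ne_top (continuous_modulated n hu θ) s
  have hN := periodNorm_modulated_le hn hu hp hau hs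
  rw [← he] at hN
  have hct : periodNorm cos s ≠ ∞ := periodNorm_ne_top continuous_cos s
  rcases eq_or_ne s ∞ with rfl | hst
  · have hc : periodNorm cos ∞ = 1 := by
      refine le_antisymm ?_ ?_
      · refine eLpNormEssSup_le_of_ae_enorm_bound (Filter.Eventually.of_forall fun t => ?_)
        rw [← ofReal_norm, ← ENNReal.ofReal_one]
        exact ENNReal.ofReal_le_ofReal (abs_cos_le_one t)
      · have := enorm_le_periodNorm_top continuous_cos cos_periodic 0
        simpa using this
    have h1 : periodNorm (modulated n u θ) ∞ ≤ U := by
      refine eLpNorm_mono fun t => ?_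
      rw [norm_norm]
      exact abs_modulated_le n u θ t
    -- For s = ∞ there is no averaging: at each t the phase that makes the cosine equal to 1
    -- recovers ‖u t‖.
    have h2 : U ≤ periodNorm (modulated n u θ) ∞ + e := by
      refine eLpNormEssSup_le_of_ae_enorm_bound (Filter.Eventually.of_forall fun t => ?_)
      refine le_trans ?_ (hN θ (-(n * t + (u t).arg)))
      have := enorm_le_periodNorm_top (continuous_modulated n hu (-(n * t + (u t).arg)))
        (modulated_periodic n hp _) t
      rwa [modulated_eq, show (n : ℝ) * t + -(n * t + (u t).arg) + (u t).arg = 0 by ring, cos_zero,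
        mul_one] at this
    have h1' := ENNReal.toReal_mono hUt h1
    have h2' := ENNReal.toReal_mono (ENNReal.add_ne_top.mpr ⟨hNt θ, het⟩) h2
    rw [ENNReal.toReal_add (hNt θ) het, hae] at h2'
    have h3 : 0 ≤ a * U.toReal := by positivity
    rw [hc]
    simp only [ENNReal.toReal_one, one_div, ENNReal.inv_top, ENNReal.toReal_zero, rpow_zero,
      div_one, one_mul]
    rw [abs_le]
    constructor <;> linarith
  · have h0 : s ≠ 0 := (zero_lt_one.trans_le hs).ne'
    have hp0 := ENNReal.toReal_pos h0 hst
    have hvol : periodMeasure Set.univ = ENNReal.ofReal (2 * π) := by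
      rw [Measure.restrict_apply_univ, Real.volume_Ico, sub_zero]
    have havg := lintegral_periodNorm_modulated n hu hs hst
    rw [← hU] at havg
    have hroot : ((periodNorm cos s ^ s.toReal * U ^ s.toReal).toReal) =
        2 * π * ((periodNorm cos s).toReal / (2 * π) ^ (1 / s).toReal * U.toReal) ^ s.toReal := by
      rw [ENNReal.toReal_mul, ← ENNReal.toReal_rpow, ← ENNReal.toReal_rpow,
        mul_rpow (by positivity) (by positivity), div_rpow (by positivity) (by positivity),
        ← rpow_mul (by positivity), toReal_one_div_of_one_le, one_div_mul_cancel hp0.ne', rpow_one]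
      field_simp
    set V := (periodNorm cos s).toReal / (2 * π) ^ (1 / s).toReal * U.toReal with hV
    have hV0 : 0 ≤ V := by positivity
    have hfin : periodNorm cos s ^ s.toReal * U ^ s.toReal ≠ ∞ := by finiteness
    -- The norm at each phase θ' lies within e of the norm at θ; integrating s-th powers over θ'
    -- encloses the exact mean. Subtraction in `hlo` is truncated at 0, which keeps the lower bound
    -- valid.
    have hup : periodNorm cos s ^ s.toReal * U ^ s.toReal ≤
        (periodNorm (modulated n u θ) s + e) ^ s.toReal * ENNReal.ofReal (2 * π) := by
      rw [← havg, ← hvol, ← lintegral_const]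
      exact lintegral_mono fun θ' => ENNReal.rpow_le_rpow (hN θ θ') hp0.le
    have hlo : (periodNorm (modulated n u θ) s - e) ^ s.toReal * ENNReal.ofReal (2 * π) ≤
        periodNorm cos s ^ s.toReal * U ^ s.toReal := by
      rw [← havg, ← hvol, ← lintegral_const]
      exact lintegral_mono fun θ' =>
        ENNReal.rpow_le_rpow (tsub_le_iff_right.mpr (hN θ' θ)) hp0.le
    have hN' := hNt θ
    have h1 := ENNReal.toReal_mono (by finiteness) hup
    have h2 := ENNReal.toReal_mono hfin hlo
    rw [hroot, ENNReal.toReal_mul, ENNReal.toReal_ofReal two_pi_pos.le, ← ENNReal.toReal_rpow,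
      ENNReal.toReal_add hN' het, hae, mul_comm, mul_le_mul_iff_left₀ two_pi_pos,
      rpow_le_rpow_iff hV0 (by positivity) hp0] at h1
    rw [hroot, ENNReal.toReal_mul, ENNReal.toReal_ofReal two_pi_pos.le, ← ENNReal.toReal_rpow,
      mul_comm (2 * π), mul_le_mul_iff_left₀ two_pi_pos,
      rpow_le_rpow_iff (by positivity) hV0 hp0] at h2
    have h3 := ENNReal.le_toReal_sub (a := periodNorm (modulated n u θ) s) het
    rw [hae] at h3
    rw [abs_le]
    constructor <;> linarith

/-! ### Coefficients of the tail. -/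

/-- Bernoulli's inequality for concave powers at 1/x; the next lemma uses it at -1/(x + 1). -/
theorem add_one_rpow_sub_le {x r : ℝ} (hx : 0 < x) (hr₀ : 0 ≤ r) (hr₁ : r ≤ 1) :
    (x + 1) ^ r - x ^ r ≤ r * x ^ (r - 1) := by
  have h := rpow_one_add_le_one_add_mul_self (s := 1 / x) (by
    have : 0 < 1 / x := by positivity
    linarith) hr₀ hr₁
  have e : (x + 1) ^ r = x ^ r * (1 + 1 / x) ^ r := by
    rw [← mul_rpow hx.le (by positivity)]
    congr 1
    field_simp
  rw [e, rpow_sub_one hx.ne']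
  have := mul_le_mul_of_nonneg_left h (rpow_nonneg hx.le r)
  calc x ^ r * (1 + 1 / x) ^ r - x ^ r ≤ x ^ r * (1 + r * (1 / x)) - x ^ r := by linarith
    _ = _ := by ring

theorem le_add_one_rpow_sub {x r : ℝ} (hx : 0 ≤ x) (hr₀ : 0 ≤ r) (hr₁ : r ≤ 1) :
    r * (x + 1) ^ (r - 1) ≤ (x + 1) ^ r - x ^ r := by
  have hx1 : 0 < x + 1 := by linarith
  have h2 : -1 ≤ -(1 / (x + 1)) := by
    rw [neg_le_neg_iff, div_le_one hx1]; linarith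
  have h := rpow_one_add_le_one_add_mul_self h2 hr₀ hr₁
  have e : x ^ r = (x + 1) ^ r * (1 + -(1 / (x + 1))) ^ r := by
    rw [← mul_rpow hx1.le (by linarith)]
    congr 1
    field_simp
    ring
  rw [e, rpow_sub_one hx1.ne']
  have := mul_le_mul_of_nonneg_left h (rpow_nonneg hx1.le r)
  calc r * ((x + 1) ^ r / (x + 1)) = (x + 1) ^ r - (x + 1) ^ r * (1 + r * -(1 / (x + 1))) := by ring
    _ ≤ _ := by linarith

/-- The coefficients of the tail of the kernel, divided by the first one. -/
def tailCoeff (α r : ℝ) (n k : ℕ) : ℝ := exp (-α * (((n + k : ℕ) : ℝ) ^ r - (n : ℝ) ^ r))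

theorem tailCoeff_zero (α r : ℝ) (n : ℕ) : tailCoeff α r n 0 = 1 := by simp [tailCoeff]

theorem tailCoeff_pos (α r : ℝ) (n k : ℕ) : 0 < tailCoeff α r n k := exp_pos _

theorem tailCoeff_eq_succ_mul (α r : ℝ) (n k : ℕ) : tailCoeff α r n k =
    tailCoeff α r n (k + 1) * exp (α * ((((n + k : ℕ) : ℝ) + 1) ^ r - ((n + k : ℕ) : ℝ) ^ r)) := by
  rw [tailCoeff, tailCoeff, ← exp_add]
  congr 1
  push_cast
  ring_nf

section
variable {α r : ℝ} {n : ℕ} (hr₀ : 0 < r) (hr₁ : r < 1) (hα : 0 < α) (hn : 1 ≤ n)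
include hr₀ hr₁ hα hn

/-- The increments of k^r for k ≥ n are at most r n^(r-1), by concavity. This is q l_k ≤ l_{k+1}
with q = e^{-δ}. -/
theorem exp_neg_mul_tailCoeff_le (k : ℕ) :
    exp (-(α * r / (n : ℝ) ^ (1 - r))) * tailCoeff α r n k ≤ tailCoeff α r n (k + 1) := by
  have hn' : (0 : ℝ) < n := by exact_mod_cast hn
  have hx : (n : ℝ) ≤ ((n + k : ℕ) : ℝ) := by exact_mod_cast Nat.le_add_right n k
  have h1 := add_one_rpow_sub_le (hn'.trans_le hx) hr₀.le hr₁.le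
  have h2 : ((n + k : ℕ) : ℝ) ^ (r - 1) ≤ (n : ℝ) ^ (r - 1) :=
    rpow_le_rpow_of_nonpos hn' hx (by linarith)
  have h3 : α * r / (n : ℝ) ^ (1 - r) = α * (r * (n : ℝ) ^ (r - 1)) := by
    rw [show r - 1 = -(1 - r) by ring, rpow_neg hn'.le]
    field_simp
  rw [tailCoeff_eq_succ_mul, mul_left_comm, ← exp_add]
  refine mul_le_of_le_one_right (tailCoeff_pos _ _ _ _).le (exp_le_one_iff.mpr ?_)
  rw [h3]
  have : ((((n + k : ℕ) : ℝ) + 1) ^ r - ((n + k : ℕ) : ℝ) ^ r) ≤ r * (n : ℝ) ^ (r - 1) :=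
    h1.trans (by gcongr)
  nlinarith

/-- Discrete form of -(d/dx)[x^(1-r) e^{-αx^r}/(αr)] = e^{-αx^r} (1 - (1-r)x^{-r}/(αr)). One ε pays
for the growth of x^(1-r), the other for the step from x to x + 1, through 1/n = δε ≤ ε. -/
theorem tailCoeff_telescope (hδ : α * r / (n : ℝ) ^ (1 - r) ≤ 1) (k : ℕ) :
    (1 - 2 * (1 / (α * r) * (1 / (n : ℝ) ^ r))) * tailCoeff α r n (k + 1) ≤
      ((n + k : ℕ) : ℝ) ^ (1 - r) / (α * r) * tailCoeff α r n k -
      ((n + (k + 1) : ℕ) : ℝ) ^ (1 - r) / (α * r) * tailCoeff α r n (k + 1) := by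
  have hn' : (0 : ℝ) < n := by exact_mod_cast hn
  have hc : ((n + (k + 1) : ℕ) : ℝ) = ((n + k : ℕ) : ℝ) + 1 := by push_cast; ring
  rw [hc, tailCoeff_eq_succ_mul α r n k]
  have hx : (n : ℝ) ≤ ((n + k : ℕ) : ℝ) := by exact_mod_cast Nat.le_add_right n k
  set x : ℝ := ((n + k : ℕ) : ℝ) with hxdef
  have hx0 : 0 < x := hn'.trans_le hx
  have hαr : 0 < α * r := mul_pos hα hr₀
  set l := tailCoeff α r n (k + 1) with hl
  have hl0 : 0 < l := tailCoeff_pos _ _ _ _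
  have h1 : 1 + α * (r * (x + 1) ^ (r - 1)) ≤ exp (α * ((x + 1) ^ r - x ^ r)) := by
    have i1 := le_add_one_rpow_sub hx0.le hr₀.le hr₁.le
    have i2 := add_one_le_exp (α * ((x + 1) ^ r - x ^ r))
    nlinarith
  have h2 : (x + 1) ^ (1 - r) - x ^ (1 - r) ≤ 1 / (n : ℝ) ^ r := by
    have i1 := add_one_rpow_sub_le hx0 (r := 1 - r) (by linarith) (by linarith)
    refine i1.trans ?_
    rw [show 1 - r - 1 = -r by ring, rpow_neg hx0.le, one_div]
    have i2 : (x ^ r)⁻¹ ≤ ((n : ℝ) ^ r)⁻¹ := by gcongr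
    have i3 : 0 < (x ^ r)⁻¹ := by positivity
    nlinarith
  have h3 : 1 - 1 / (n : ℝ) ≤ x ^ (1 - r) * (x + 1) ^ (r - 1) := by
    have i1 : x ^ (1 - r) * (x + 1) ^ (r - 1) = (x / (x + 1)) ^ (1 - r) := by
      rw [div_rpow hx0.le (by positivity), show r - 1 = -(1 - r) by ring,
        rpow_neg (by positivity), div_eq_mul_inv]
    have i2 : x / (x + 1) ≤ (x / (x + 1)) ^ (1 - r) :=
      self_le_rpow_of_le_one (by positivity) (by rw [div_le_one] <;> linarith) (by linarith)
    have i3 : 1 - 1 / (n : ℝ) ≤ x / (x + 1) := by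
      have : 1 / (x + 1) ≤ 1 / (n : ℝ) := by gcongr; linarith
      have e : x / (x + 1) = 1 - 1 / (x + 1) := by field_simp; ring
      linarith
    rw [i1]; linarith
  have h4 : 1 / (n : ℝ) ≤ 1 / (α * r) * (1 / (n : ℝ) ^ r) := by
    have e : 1 / (n : ℝ) = α * r / (n : ℝ) ^ (1 - r) * (1 / (α * r) * (1 / (n : ℝ) ^ r)) := by
      have e1 : (n : ℝ) = (n : ℝ) ^ (1 - r) * (n : ℝ) ^ r := by
        rw [← rpow_add hn']; simp
      conv_lhs => rw [e1]
      field_simp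
    rw [e]
    exact mul_le_of_le_one_left (by positivity) hδ
  calc (1 - 2 * (1 / (α * r) * (1 / (n : ℝ) ^ r))) * l
      ≤ (x ^ (1 - r) / (α * r) * (1 + α * (r * (x + 1) ^ (r - 1))) -
          (x + 1) ^ (1 - r) / (α * r)) * l := by
        refine mul_le_mul_of_nonneg_right ?_ hl0.le
        have e : x ^ (1 - r) / (α * r) * (1 + α * (r * (x + 1) ^ (r - 1))) -
          (x + 1) ^ (1 - r) / (α * r) = x ^ (1 - r) * (x + 1) ^ (r - 1) -
            1 / (α * r) * ((x + 1) ^ (1 - r) - x ^ (1 - r)) := by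
          field_simp
          ring
        rw [e]
        have := mul_le_mul_of_nonneg_left h2 (by positivity : 0 ≤ 1 / (α * r))
        linarith
    _ = x ^ (1 - r) / (α * r) * (l * (1 + α * (r * (x + 1) ^ (r - 1)))) -
          (x + 1) ^ (1 - r) / (α * r) * l := by ring
    _ ≤ _ := by gcongr

theorem sum_tailCoeff_succ_le (hδ : α * r / (n : ℝ) ^ (1 - r) ≤ 1)
    (hε : 1 / (α * r) * (1 / (n : ℝ) ^ r) < 1 / 2) (N : ℕ) :
    ∑ k ∈ Finset.range N, tailCoeff α r n (k + 1) ≤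
      1 / ((α * r / (n : ℝ) ^ (1 - r)) * (1 - 2 * (1 / (α * r) * (1 / (n : ℝ) ^ r)))) := by
  have hn' : (0 : ℝ) < n := by exact_mod_cast hn
  have hαr : 0 < α * r := mul_pos hα hr₀
  have h0 : 0 < 1 - 2 * (1 / (α * r) * (1 / (n : ℝ) ^ r)) := by linarith
  have h1 := Finset.sum_le_sum fun k (_ : k ∈ Finset.range N) =>
    tailCoeff_telescope hr₀ hr₁ hα hn hδ k
  -- The telescoped sum leaves the boundary term at k = 0, namely n^(1-r)/(αr) = 1/δ.
  rw [← Finset.mul_sum, Finset.sum_range_sub'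
    (fun k => ((n + k : ℕ) : ℝ) ^ (1 - r) / (α * r) * tailCoeff α r n k) N, tailCoeff_zero] at h1
  have h2 : 0 ≤ ((n + N : ℕ) : ℝ) ^ (1 - r) / (α * r) * tailCoeff α r n N :=
    mul_nonneg (by positivity) (tailCoeff_pos _ _ _ _).le
  have e : 1 / ((α * r / (n : ℝ) ^ (1 - r)) * (1 - 2 * (1 / (α * r) * (1 / (n : ℝ) ^ r)))) =
      ((n : ℝ) ^ (1 - r) / (α * r)) / (1 - 2 * (1 / (α * r) * (1 / (n : ℝ) ^ r))) := by
    rw [one_div, mul_inv, inv_div, div_eq_mul_inv (_ / _)]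
  rw [e, le_div_iff₀ h0, mul_comm]
  simp only [add_zero, mul_one] at h1
  linarith

theorem summable_tailCoeff (hδ : α * r / (n : ℝ) ^ (1 - r) ≤ 1)
    (hε : 1 / (α * r) * (1 / (n : ℝ) ^ r) < 1 / 2) : Summable (tailCoeff α r n) :=
  (summable_nat_add_iff 1).mp (summable_of_sum_range_le (fun _ => (tailCoeff_pos _ _ _ _).le)
    (sum_tailCoeff_succ_le hr₀ hr₁ hα hn hδ hε))

theorem tsum_tailCoeff_le (hδ : α * r / (n : ℝ) ^ (1 - r) ≤ 1)
    (hε : 1 / (α * r) * (1 / (n : ℝ) ^ r) < 1 / 2) : ∑' k, tailCoeff α r n k ≤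
      1 + 1 / ((α * r / (n : ℝ) ^ (1 - r)) * (1 - 2 * (1 / (α * r) * (1 / (n : ℝ) ^ r)))) := by
  have hs := summable_tailCoeff hr₀ hr₁ hα hn hδ hε
  rw [hs.tsum_eq_zero_add, tailCoeff_zero]
  have := Real.tsum_le_of_sum_range_le (fun k => (tailCoeff_pos α r n (k + 1)).le)
    (sum_tailCoeff_succ_le hr₀ hr₁ hα hn hδ hε)
  linarith

end

/-! ### The geometric kernel and the comparison of power series with it. -/

/-- The geometric series `1 / (1 - q exp (i t))`. -/
def geomKernel (q t : ℝ) : ℂ := 1 / (1 - q * Complex.exp (t * Complex.I))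

theorem norm_one_sub_mul_exp_sq (q t : ℝ) :
    ‖1 - (q : ℂ) * Complex.exp (t * Complex.I)‖ ^ 2 = (1 - q) ^ 2 + 2 * q * (1 - cos t) := by
  rw [← Complex.normSq_eq_norm_sq, Complex.normSq_apply]
  have h1 : (1 - (q : ℂ) * Complex.exp (t * Complex.I)).re = 1 - q * cos t := by
    simp [Complex.exp_ofReal_mul_I_re]
  have h2 : (1 - (q : ℂ) * Complex.exp (t * Complex.I)).im = -(q * sin t) := by
    simp [Complex.exp_ofReal_mul_I_im]
  rw [h1, h2]
  linear_combination q ^ 2 * sin_sq_add_cos_sq t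

theorem one_sub_le_norm {q : ℝ} (hq : 0 ≤ q) (t : ℝ) :
    1 - q ≤ ‖1 - (q : ℂ) * Complex.exp (t * Complex.I)‖ := by
  refine le_of_sq_le_sq ?_ (norm_nonneg _)
  rw [norm_one_sub_mul_exp_sq]
  nlinarith [cos_le_one t]

theorem one_sub_mul_exp_ne_zero {q : ℝ} (hq : 0 ≤ q) (hq1 : q < 1) (t : ℝ) :
    1 - (q : ℂ) * Complex.exp (t * Complex.I) ≠ 0 := by
  have := one_sub_le_norm hq t
  rw [← norm_pos_iff]
  linarith

theorem norm_geomKernel_le {q : ℝ} (hq : 0 ≤ q) (hq1 : q < 1) (t : ℝ) :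
    ‖geomKernel q t‖ ≤ 1 / (1 - q) := by
  rw [geomKernel, norm_div, norm_one]
  exact one_div_le_one_div_of_le (by linarith) (one_sub_le_norm hq t)

theorem continuous_geomKernel {q : ℝ} (hq : 0 ≤ q) (hq1 : q < 1) :
    Continuous (geomKernel q) := by
  unfold geomKernel
  exact Continuous.div (by fun_prop) (by fun_prop) fun t => one_sub_mul_exp_ne_zero hq hq1 t

theorem geomKernel_periodic (q : ℝ) : Function.Periodic (geomKernel q) (2 * π) := fun t => by
  rw [geomKernel, geomKernel]
  push_cast
  rw [add_mul, Complex.exp_periodic]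

/-- From u(t+h) - u(t) = q e^{it} (e^{ih} - 1) u(t+h) u(t), with |u(t+h)| ≤ 1/(1-q). The error is
relative to |u(t)|, as the averaging argument requires. -/
theorem norm_geomKernel_add_sub_le {q : ℝ} (hq : 0 ≤ q) (hq1 : q < 1) (t h : ℝ) :
    ‖geomKernel q (t + h) - geomKernel q t‖ ≤ |h| / (1 - q) * ‖geomKernel q t‖ := by
  have n1 := one_sub_mul_exp_ne_zero hq hq1 t
  have n2 := one_sub_mul_exp_ne_zero hq hq1 (t + h)
  have e : geomKernel q (t + h) - geomKernel q t = q * Complex.exp (t * Complex.I) *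
      (Complex.exp (Complex.I * h) - 1) * geomKernel q (t + h) * geomKernel q t := by
    have : Complex.exp ((t + h : ℝ) * Complex.I) =
      Complex.exp (t * Complex.I) * Complex.exp (Complex.I * h) := by
      rw [← Complex.exp_add]; push_cast; ring_nf
    rw [geomKernel, geomKernel, div_sub_div _ _ n2 n1, mul_one_div, mul_one_div, div_div]
    congr 1
    rw [this]
    ring
  rw [e, norm_mul]
  refine mul_le_mul_of_nonneg_right ?_ (norm_nonneg _)
  rw [norm_mul, norm_mul, norm_mul, Complex.norm_exp_ofReal_mul_I, Complex.norm_real,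
    Real.norm_of_nonneg hq, mul_one, div_eq_mul_one_div]
  have h1 : ‖Complex.exp (Complex.I * h) - 1‖ ≤ |h| := norm_exp_I_mul_ofReal_sub_one_le
  have h2 := norm_geomKernel_le hq hq1 (t + h)
  calc q * ‖Complex.exp (Complex.I * h) - 1‖ * ‖geomKernel q (t + h)‖
      ≤ 1 * |h| * (1 / (1 - q)) := by gcongr
    _ = _ := by ring

/-- The power series with coefficients `l` on the unit circle. -/
def boundarySeries (l : ℕ → ℝ) (t : ℝ) : ℂ := ∑' k, (l k : ℂ) * Complex.exp (k * t * Complex.I)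

theorem norm_boundarySeries_term {l : ℕ → ℝ} (hl0 : ∀ k, 0 ≤ l k) (t : ℝ) (k : ℕ) :
    ‖(l k : ℂ) * Complex.exp (k * t * Complex.I)‖ = l k := by
  have := Complex.norm_exp_ofReal_mul_I (k * t)
  push_cast at this
  rw [norm_mul, this, mul_one, Complex.norm_real, Real.norm_of_nonneg (hl0 k)]

/-- Multiplying by 1 - qz gives 1 + ∑ (l_{k+1} - q l_k) z^{k+1}. These coefficients are nonnegative,
so the modulus of the sum is largest at z = 1. -/
theorem norm_boundarySeries_sub_le {l : ℕ → ℝ} (hl : Summable l) (hl0 : ∀ k, 0 ≤ l k)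
    (hl1 : l 0 = 1) {q : ℝ} (hq : 0 ≤ q) (hq1 : q < 1) (hlq : ∀ k, q * l k ≤ l (k + 1)) (t : ℝ) :
    ‖boundarySeries l t - geomKernel q t‖ ≤ ((1 - q) * ∑' k, l k - 1) * ‖geomKernel q t‖ := by
  have n1 := one_sub_mul_exp_ne_zero hq hq1 t
  set z := Complex.exp (t * Complex.I) with hz
  have hz1 : ‖z‖ = 1 := Complex.norm_exp_ofReal_mul_I t
  have hterm : ∀ k : ℕ, Complex.exp (k * t * Complex.I) = z ^ k := fun k => by
    rw [hz, ← Complex.exp_nat_mul]; ring_nf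
  have hS : Summable fun k => (l k : ℂ) * z ^ k := by
    refine Summable.of_norm ?_
    simpa [hz1, abs_of_nonneg (hl0 _)] using hl
  have hF : boundarySeries l t = ∑' k, (l k : ℂ) * z ^ k := tsum_congr fun k => by rw [hterm]
  have hs1 : Summable fun k => l (k + 1) := (summable_nat_add_iff 1).mpr hl
  have hsub : Summable fun k => l (k + 1) - q * l k := hs1.sub (hl.mul_left q)
  have e1 : (1 - q * z) * boundarySeries l t - 1 =
      ∑' k, ((l (k + 1) - q * l k : ℝ) : ℂ) * z ^ (k + 1) := by
    have hS1 : Summable fun k => (l (k + 1) : ℂ) * z ^ (k + 1) :=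
      (summable_nat_add_iff (f := fun k => (l k : ℂ) * z ^ k) 1).mpr hS
    have a1 : boundarySeries l t = 1 + ∑' k, (l (k + 1) : ℂ) * z ^ (k + 1) := by
      rw [hF, hS.tsum_eq_zero_add, hl1]; simp
    have a2 : (q * z) * boundarySeries l t = ∑' k, (q * z) * ((l k : ℂ) * z ^ k) := by
      rw [hF, tsum_mul_left]
    rw [sub_mul, one_mul, a2]
    conv_lhs => enter [1, 1]; rw [a1]
    rw [sub_right_comm, add_sub_cancel_left, ← hS1.tsum_sub (hS.mul_left _)]
    refine tsum_congr fun k => ?_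
    push_cast
    ring
  have e2 : ‖(1 - q * z) * boundarySeries l t - 1‖ ≤ (1 - q) * ∑' k, l k - 1 := by
    rw [e1]
    have hn : ∀ k, ‖((l (k + 1) - q * l k : ℝ) : ℂ) * z ^ (k + 1)‖ = l (k + 1) - q * l k := by
      intro k
      rw [norm_mul, norm_pow, hz1, one_pow, mul_one, Complex.norm_real,
        Real.norm_of_nonneg (sub_nonneg.mpr (hlq k))]
    refine (norm_tsum_le_tsum_norm (by simpa only [hn] using hsub)).trans_eq ?_
    simp_rw [hn]
    rw [hs1.tsum_sub (hl.mul_left q), tsum_mul_left, hl.tsum_eq_zero_add, hl1]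
    ring
  have e3 : boundarySeries l t - geomKernel q t =
      ((1 - q * z) * boundarySeries l t - 1) * geomKernel q t := by
    rw [geomKernel, ← hz]
    field_simp
  rw [e3, norm_mul]
  gcongr

/-! ### Modulus of the geometric kernel near its peak. -/

/-- Mean value inequality on the left half-plane, where |exp| ≤ 1. The next lemma applies it to exp
w - w on the half-plane intersected with a ball, its derivative being bounded by this one. -/
theorem norm_exp_sub_one_le_of_re_nonpos {z : ℂ} (hz : z.re ≤ 0) :
    ‖Complex.exp z - 1‖ ≤ ‖z‖ := by
  have h := (convex_halfSpace_re_le (0 : ℝ)).norm_image_sub_le_of_norm_deriv_le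
    (f := Complex.exp) (C := 1) (x := 0) (y := z)
    (fun w _ => Complex.differentiable_exp w)
    (fun w hw => by
      rw [Complex.deriv_exp, Complex.norm_exp]
      exact exp_le_one_iff.mpr hw) (by simp) hz
  simpa using h

theorem norm_exp_sub_one_sub_le_of_re_nonpos {z : ℂ} (hz : z.re ≤ 0) :
    ‖Complex.exp z - 1 - z‖ ≤ ‖z‖ ^ 2 := by
  have h := ((convex_halfSpace_re_le (0 : ℝ)).inter
    (convex_closedBall (0 : ℂ) ‖z‖)).norm_image_sub_le_of_norm_deriv_le
    (f := fun w => Complex.exp w - w) (C := ‖z‖) (x := 0) (y := z)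
    (fun w _ => (Complex.differentiable_exp w).sub differentiableAt_id)
    (fun w hw => by
      have : HasDerivAt (fun w => Complex.exp w - w) (Complex.exp w - 1) w :=
        (Complex.hasDerivAt_exp w).sub (hasDerivAt_id w)
      rw [this.deriv]
      exact (norm_exp_sub_one_le_of_re_nonpos hw.1).trans (by simpa using hw.2))
    (by simp) ⟨hz, by simp⟩
  simp only [Complex.exp_zero, sub_zero] at h
  rwa [← sq, sub_right_comm] at h

theorem half_le_one_sub_exp_neg {δ : ℝ} (hδ : 0 < δ) (hδ1 : δ ≤ 1) :
    δ / 2 ≤ 1 - exp (-δ) := by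
  have h1 : exp (-δ) ≤ 1 / (1 + δ) := by
    rw [exp_neg, ← one_div]
    exact one_div_le_one_div_of_le (by linarith) (by linarith [add_one_le_exp δ])
  have h2 : 1 / (1 + δ) ≤ 1 - δ / 2 := by
    rw [div_le_iff₀ (by linarith)]
    nlinarith
  linarith

/-- On `[-π, π]` the geometric kernel differs from `1 / (δ - i t)` in modulus by at most two. -/
theorem abs_norm_geomKernel_sub_le {δ t : ℝ} (hδ : 0 < δ) (hδ1 : δ ≤ 1 / 14) (ht : |t| ≤ π) :
    |‖geomKernel (exp (-δ)) t‖ - 1 / √(t ^ 2 + δ ^ 2)| ≤ 2 := by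
  set z : ℂ := ((-δ : ℝ) : ℂ) + t * Complex.I with hz
  have hzsq : ‖z‖ ^ 2 = t ^ 2 + δ ^ 2 := by
    rw [← Complex.normSq_eq_norm_sq, hz, Complex.normSq_add_mul_I]
    ring
  have hzn : ‖z‖ = √(t ^ 2 + δ ^ 2) := by
    rw [← hzsq, sqrt_sq (norm_nonneg _)]
  have hz0 : 0 < ‖z‖ := by rw [hzn]; positivity
  have hre : z.re ≤ 0 := by simp [hz, hδ.le]
  have he : (exp (-δ) : ℂ) * Complex.exp (t * Complex.I) = Complex.exp z := by
    rw [hz, Complex.exp_add, Complex.ofReal_exp]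
  -- This excludes other near-zeros of 1 - e^z on |t| ≤ π. It rests on 1 - cos t ≥ 2t²/π² ≥ t²/5 and
  -- 1 - e^{-δ} ≥ δ/2.
  have hlow : ‖z‖ / 2 ≤ ‖1 - Complex.exp z‖ := by
    refine le_of_sq_le_sq ?_ (norm_nonneg _)
    rw [← he, norm_one_sub_mul_exp_sq, div_pow, hzsq]
    have h1 := half_le_one_sub_exp_neg hδ (by linarith)
    have h2 : 13 / 14 ≤ exp (-δ) := by linarith [add_one_le_exp (-δ)]
    have h3 := cos_le_one_sub_mul_cos_sq ht
    have h4 : t ^ 2 / 5 ≤ 2 / π ^ 2 * t ^ 2 := by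
      have : 1 / 5 ≤ 2 / π ^ 2 := by
        rw [div_le_div_iff₀ (by norm_num) (by positivity)]
        nlinarith [pi_lt_d2, pi_pos]
      nlinarith [sq_nonneg t]
    have h5 : δ ^ 2 / 4 ≤ (1 - exp (-δ)) ^ 2 := by nlinarith
    have h6 : 2 * (13 / 14) * (t ^ 2 / 5) ≤ 2 * exp (-δ) * (1 - cos t) := by
      have : 0 ≤ t ^ 2 / 5 := by positivity
      gcongr
      linarith
    nlinarith [sq_nonneg t]
  have htay : ‖1 - Complex.exp z + z‖ ≤ ‖z‖ ^ 2 := by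
    rw [← norm_neg, show -(1 - Complex.exp z + z) = Complex.exp z - 1 - z by ring]
    exact norm_exp_sub_one_sub_le_of_re_nonpos hre
  have hpos : 0 < ‖1 - Complex.exp z‖ := by linarith
  rw [geomKernel, he, norm_div, norm_one, ← hzn,
    div_sub_div _ _ hpos.ne' hz0.ne', abs_div, abs_of_pos (mul_pos hpos hz0),
    div_le_iff₀ (mul_pos hpos hz0)]
  -- The numerator is at most ‖z‖², and the denominator is at least ‖z‖²/2 by `hlow`: hence the
  -- bound 2.
  have h1 : |1 * ‖z‖ - ‖1 - Complex.exp z‖ * 1| ≤ ‖z‖ ^ 2 := by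
    have := abs_norm_sub_norm_le (-z) (1 - Complex.exp z)
    rw [norm_neg, show -z - (1 - Complex.exp z) = -(1 - Complex.exp z + z) by ring, norm_neg] at this
    rw [one_mul, mul_one]
    exact this.trans htay
  nlinarith

/-! ### From the model function to 𝓙_s. -/

/-- The map t ↦ |t| pushes Lebesgue measure on (-a, a] to twice Lebesgue measure on [0, a]. -/
theorem eLpNorm_restrict_Ioc_of_even {g : ℝ → ℝ} (hg : Continuous g) (he : ∀ t, g (-t) = g t)
    (a : ℝ) {s : ℝ≥0∞} :
    eLpNorm g s (volume.restrict (Set.Ioc (-a) a)) =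
      (2 : ℝ≥0∞) ^ (1 / s).toReal * eLpNorm g s (volume.restrict (Set.Icc 0 a)) := by
  rcases lt_or_ge a 0 with ha | ha
  · simp [Set.Ioc_eq_empty_of_le (by linarith : a ≤ -a), Set.Icc_eq_empty_of_lt ha]
  have hm : Measurable fun t : ℝ => |t| := measurable_norm
  have h1 : (volume.restrict (Set.Ioc (-a) a)).map (fun t : ℝ => |t|) =
      (2 : ℝ≥0∞) • volume.restrict (Set.Icc 0 a) := by
    rw [← Set.Ioc_union_Ioc_eq_Ioc (by linarith : -a ≤ 0) ha,
      Measure.restrict_union (Set.Ioc_disjoint_Ioc_of_le le_rfl) measurableSet_Ioc,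
      Measure.map_add _ _ hm]
    have m1 : (volume.restrict (Set.Ioc (-a) 0)).map (fun t : ℝ => |t|) =
        volume.restrict (Set.Icc 0 a) := by
      have i1 : (fun t : ℝ => |t|) =ᵐ[volume.restrict (Set.Ioc (-a) 0)] fun t => -t := by
        filter_upwards [ae_restrict_mem measurableSet_Ioc] with t ht
        exact abs_of_nonpos ht.2
      rw [Measure.map_congr i1, ← restrict_Ico_eq_restrict_Icc]
      have := ((Measure.measurePreserving_neg (volume : Measure ℝ)).restrict_preimage
        (s := Set.Ico 0 a) measurableSet_Ico).map_eq
      simpa using this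
    have m2 : (volume.restrict (Set.Ioc 0 a)).map (fun t : ℝ => |t|) =
        volume.restrict (Set.Icc 0 a) := by
      have i1 : (fun t : ℝ => |t|) =ᵐ[volume.restrict (Set.Ioc 0 a)] id := by
        filter_upwards [ae_restrict_mem measurableSet_Ioc] with t ht
        exact abs_of_nonneg ht.1.le
      rw [Measure.map_congr i1, Measure.map_id, ← restrict_Ioc_eq_restrict_Icc]
    rw [m1, m2, two_smul]
  have h2 : g = g ∘ fun t : ℝ => |t| := by
    funext t
    rcases abs_choice t with h | h <;> simp [h, he]
  conv_lhs => rw [h2]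
  rw [← eLpNorm_map_measure hg.aestronglyMeasurable hm.aemeasurable, h1,
    eLpNorm_smul_measure_of_ne_zero two_ne_zero, smul_eq_mul, toReal_one_div_of_one_le]

theorem restrict_Icc_eq_smul_map {δ : ℝ} (hδ : 0 < δ) (a : ℝ) :
    (volume.restrict (Set.Icc 0 a) : Measure ℝ) =
      ENNReal.ofReal δ • (volume.restrict (Set.Icc 0 (a / δ))).map (δ * ·) := by
  have h := Real.smul_map_volume_mul_left hδ.ne'
  have e : (δ * ·) ⁻¹' Set.Icc 0 a = Set.Icc 0 (a / δ) := by
    rw [Set.preimage_const_mul_Icc₀ _ _ hδ, zero_div]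
  conv_lhs => rw [← h]
  rw [Measure.restrict_smul, Measure.restrict_map (measurable_const_mul δ) measurableSet_Icc, e,
    abs_of_pos hδ]

theorem continuous_one_div_sqrt {δ : ℝ} (hδ : 0 < δ) :
    Continuous fun t : ℝ => 1 / √(t ^ 2 + δ ^ 2) :=
  Continuous.div (by fun_prop) (by fun_prop) fun t => by positivity

/-- Dilation t = δx: the measure contributes δ^(1/s) and the function δ^(-1). -/
theorem eLpNorm_one_div_sqrt {δ : ℝ} (hδ : 0 < δ) (a : ℝ) {s : ℝ≥0∞} :
    (eLpNorm (fun t : ℝ => 1 / √(t ^ 2 + δ ^ 2)) s (volume.restrict (Set.Icc 0 a))).toReal =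
      δ ^ ((1 / s).toReal - 1) * J s (a / δ) := by
  rw [restrict_Icc_eq_smul_map hδ, eLpNorm_smul_measure_of_ne_zero (by simpa using hδ),
    eLpNorm_map_measure (continuous_one_div_sqrt hδ).aestronglyMeasurable
      (measurable_const_mul δ).aemeasurable, smul_eq_mul, ENNReal.toReal_mul, J]
  have h1 : ((fun t : ℝ => 1 / √(t ^ 2 + δ ^ 2)) ∘ fun x => δ * x) =
      δ⁻¹ • fun t => 1 / √(t ^ 2 + 1) := by
    funext t
    simp only [Function.comp, Pi.smul_apply, smul_eq_mul]
    rw [show (δ * t) ^ 2 + δ ^ 2 = δ ^ 2 * (t ^ 2 + 1) by ring, sqrt_mul (by positivity),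
      sqrt_sq hδ.le]
    field_simp
  rw [h1, eLpNorm_const_smul, ENNReal.toReal_mul, toReal_enorm, norm_inv,
    Real.norm_of_nonneg hδ.le, ← mul_assoc]
  congr 1
  rw [rpow_sub_one hδ.ne', ← ENNReal.toReal_rpow, ENNReal.toReal_ofReal hδ.le,
    ENNReal.toReal_div]
  simp [div_eq_mul_inv]

/-- The norm of the geometric kernel in terms of `𝓙_s`. -/
theorem abs_periodNorm_geomKernel_sub_le {δ : ℝ} (hδ : 0 < δ) (hδ1 : δ ≤ 1 / 14) {s : ℝ≥0∞}
    (hs : 1 ≤ s) :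
    |(periodNorm (fun t => ‖geomKernel (exp (-δ)) t‖) s).toReal -
      2 ^ (1 / s).toReal * (δ ^ ((1 / s).toReal - 1) * J s (π / δ))| ≤ 4 * π := by
  have hq1 : exp (-δ) < 1 := by simpa using hδ
  set f : ℝ → ℝ := fun t => ‖geomKernel (exp (-δ)) t‖ with hf
  have hfc : Continuous f := (continuous_geomKernel (exp_pos _).le hq1).norm
  have hfp : Function.Periodic f (2 * π) := fun t => by
    simp only [hf]; rw [geomKernel_periodic]
  set g : ℝ → ℝ := fun t : ℝ => 1 / √(t ^ 2 + δ ^ 2) with hg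
  have hgc : Continuous g := continuous_one_div_sqrt hδ
  set ν : Measure ℝ := volume.restrict (Set.Ioc (-π) (-π + 2 * π)) with hν
  have hconst : (eLpNorm (fun _ : ℝ => (2 : ℝ)) s ν).toReal ≤ 4 * π := by
    rw [hν, eLpNorm_restrict_Ioc_of_periodic continuous_const (fun _ => rfl)]
    have := periodNorm_const_le hs (zero_le_two (α := ℝ))
    linarith
  have hfn : periodNorm f s = eLpNorm f s ν := (eLpNorm_restrict_Ioc_of_periodic hfc hfp _ _).symm
  have hgn : (eLpNorm g s ν).toReal =
      2 ^ (1 / s).toReal * (δ ^ ((1 / s).toReal - 1) * J s (π / δ)) := by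
    rw [hν, show -π + 2 * π = π by ring, eLpNorm_restrict_Ioc_of_even hgc (fun t => by simp [hg]),
      ENNReal.toReal_mul, ← ENNReal.toReal_rpow, eLpNorm_one_div_sqrt hδ]
    simp
  have hfin : ∀ h : ℝ → ℝ, Continuous h → eLpNorm h s ν ≠ ∞ := by
    intro h hc
    obtain ⟨C, hC⟩ := (isCompact_Icc (a := -π) (b := -π + 2 * π)).exists_bound_of_continuousOn
      hc.continuousOn
    refine (MemLp.of_bound (p := s) hc.aestronglyMeasurable C ?_).2.ne
    filter_upwards [ae_restrict_mem measurableSet_Ioc] with t ht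
    exact hC t (Set.Ioc_subset_Icc_self ht)
  have hcmp : ∀ h k : ℝ → ℝ, Continuous h → Continuous k → (∀ t, 0 ≤ h t) → (∀ t, 0 ≤ k t) →
      (∀ t, |t| ≤ π → h t ≤ k t + 2) →
      (eLpNorm h s ν).toReal ≤ (eLpNorm k s ν).toReal + 4 * π := by
    intro h k hc kc h0 k0 hle
    have i1 : eLpNorm h s ν ≤ eLpNorm (k + fun _ => (2 : ℝ)) s ν := by
      refine eLpNorm_mono_ae ?_
      filter_upwards [ae_restrict_mem measurableSet_Ioc] with t ht
      rw [Real.norm_of_nonneg (h0 t)]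
      refine (hle t (abs_le.mpr ⟨ht.1.le, by linarith [ht.2]⟩)).trans ?_
      exact le_abs_self _
    have i2 := i1.trans (eLpNorm_add_le kc.aestronglyMeasurable
      continuous_const.aestronglyMeasurable hs)
    have f2 := hfin (fun _ => 2) continuous_const
    have i3 := ENNReal.toReal_mono (ENNReal.add_ne_top.mpr ⟨hfin k kc, f2⟩) i2
    rw [ENNReal.toReal_add (hfin k kc) f2] at i3
    linarith
  have hpt : ∀ t, |t| ≤ π → |f t - g t| ≤ 2 := fun t ht => abs_norm_geomKernel_sub_le hδ hδ1 ht
  have g0 : ∀ t, 0 ≤ g t := fun t => by positivity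
  have j1 := hcmp f g hfc hgc (fun t => norm_nonneg _) g0
    (fun t ht => by linarith [(abs_le.mp (hpt t ht)).2])
  have j2 := hcmp g f hgc hfc g0 (fun t => norm_nonneg _)
    (fun t ht => by linarith [(abs_le.mp (hpt t ht)).1])
  rw [hfn, ← hgn, abs_le]
  constructor <;> linarith

/-! ### Orthogonality and Fourier coefficients of trigonometric series. -/

theorem integral_cos_int_mul (j : ℤ) :
    ∫ t in (-π)..π, cos (j * t) = if j = 0 then 2 * π else 0 := by
  split_ifs with h
  · simp [h]; ring
  · have h' : (j : ℝ) ≠ 0 := by exact_mod_cast h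
    rw [intervalIntegral.integral_comp_mul_left (fun t => cos t) h', integral_cos, mul_neg, sin_neg,
      sin_int_mul_pi]
    simp

theorem integral_sin_int_mul (j : ℤ) : ∫ t in (-π)..π, sin (j * t) = 0 := by
  by_cases h : j = 0
  · simp [h]
  · have h' : (j : ℝ) ≠ 0 := by exact_mod_cast h
    rw [intervalIntegral.integral_comp_mul_left (fun t => sin t) h', integral_sin, mul_neg, cos_neg]
    simp

/-- Writing the first frequency as j + 1 keeps the sum frequency nonzero, so m = 0 needs no separate
case. -/
theorem integral_cos_mul_cos (j m : ℕ) : ∫ t in (-π)..π, cos ((j + 1 : ℕ) * t) * cos (m * t) =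
    if j + 1 = m then π else 0 := by
  have e : ∀ t : ℝ, cos ((j + 1 : ℕ) * t) * cos (m * t) =
      (cos (((j + 1 - m : ℤ) : ℝ) * t) + cos (((j + 1 + m : ℤ) : ℝ) * t)) / 2 := fun t => by
    have := two_mul_cos_mul_cos ((j + 1 : ℕ) * t) (m * t)
    push_cast at this ⊢
    rw [sub_mul, add_mul _ (m : ℝ)]
    linarith
  simp_rw [e]
  rw [intervalIntegral.integral_div, intervalIntegral.integral_add
    (Continuous.intervalIntegrable (by fun_prop) _ _)
    (Continuous.intervalIntegrable (by fun_prop) _ _), integral_cos_int_mul, integral_cos_int_mul,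
    if_neg (by omega : ¬ (j + 1 + m : ℤ) = 0)]
  by_cases h : j + 1 = m
  · rw [if_pos h, if_pos (by omega)]; ring
  · rw [if_neg h, if_neg (by omega)]; ring

theorem integral_sin_mul_sin (j m : ℕ) : ∫ t in (-π)..π, sin ((j + 1 : ℕ) * t) * sin (m * t) =
    if j + 1 = m then π else 0 := by
  have e : ∀ t : ℝ, sin ((j + 1 : ℕ) * t) * sin (m * t) =
      (cos (((j + 1 - m : ℤ) : ℝ) * t) - cos (((j + 1 + m : ℤ) : ℝ) * t)) / 2 := fun t => by
    have := two_mul_sin_mul_sin ((j + 1 : ℕ) * t) (m * t)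
    push_cast at this ⊢
    rw [sub_mul, add_mul _ (m : ℝ)]
    linarith
  simp_rw [e]
  rw [intervalIntegral.integral_div, intervalIntegral.integral_sub
    (Continuous.intervalIntegrable (by fun_prop) _ _)
    (Continuous.intervalIntegrable (by fun_prop) _ _), integral_cos_int_mul, integral_cos_int_mul,
    if_neg (by omega : ¬ (j + 1 + m : ℤ) = 0)]
  by_cases h : j + 1 = m
  · rw [if_pos h, if_pos (by omega)]; ring
  · rw [if_neg h, if_neg (by omega)]; ring

theorem integral_sin_mul_cos (j m : ℕ) : ∫ t in (-π)..π, sin (j * t) * cos (m * t) = 0 := by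
  have e : ∀ t : ℝ, sin (j * t) * cos (m * t) =
      (sin (((j - m : ℤ) : ℝ) * t) + sin (((j + m : ℤ) : ℝ) * t)) / 2 := fun t => by
    have := two_mul_sin_mul_cos (j * t) (m * t)
    push_cast at this ⊢
    rw [sub_mul, add_mul]
    linarith
  simp_rw [e]
  rw [intervalIntegral.integral_div, intervalIntegral.integral_add
    (Continuous.intervalIntegrable (by fun_prop) _ _)
    (Continuous.intervalIntegrable (by fun_prop) _ _), integral_sin_int_mul, integral_sin_int_mul]
  simp

theorem summable_trig {A B : ℕ → ℝ} (hA : Summable fun k => |A k|) (hB : Summable fun k => |B k|)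
    (m : ℕ → ℝ) (x : ℝ) : Summable fun k => A k * cos (m k * x) + B k * sin (m k * x) := by
  refine Summable.add (Summable.of_norm_bounded hA fun k => ?_)
    (Summable.of_norm_bounded hB fun k => ?_)
  · rw [norm_mul]; exact mul_le_of_le_one_right (norm_nonneg _) (abs_cos_le_one _)
  · rw [norm_mul]; exact mul_le_of_le_one_right (norm_nonneg _) (abs_sin_le_one _)

/-- Integration of a trigonometric series against a bounded continuous function. -/
theorem integral_trigSeries_mul {A B : ℕ → ℝ} (hA : Summable fun k => |A k|)
    (hB : Summable fun k => |B k|) (a : ℝ) {w : ℝ → ℝ} (hw : Continuous w) (hw1 : ∀ t, |w t| ≤ 1) :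
    ∫ t in (-π)..π, (a / 2 + ∑' k, (A k * cos ((k + 1 : ℕ) * t) + B k * sin ((k + 1 : ℕ) * t))) * w t
      = a / 2 * (∫ t in (-π)..π, w t) +
        ∑' k, (A k * (∫ t in (-π)..π, cos ((k + 1 : ℕ) * t) * w t) +
          B k * ∫ t in (-π)..π, sin ((k + 1 : ℕ) * t) * w t) := by
  have hterm : ∀ (k : ℕ) t, |(A k * cos ((k + 1 : ℕ) * t) + B k * sin ((k + 1 : ℕ) * t)) * w t| ≤
      |A k| + |B k| := fun k t => by
    rw [abs_mul]
    refine (mul_le_of_le_one_right (abs_nonneg _) (hw1 t)).trans ((abs_add_le _ _).trans ?_)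
    rw [abs_mul, abs_mul]
    exact add_le_add (mul_le_of_le_one_right (abs_nonneg _) (abs_cos_le_one _))
      (mul_le_of_le_one_right (abs_nonneg _) (abs_sin_le_one _))
  have h1 : HasSum (fun k : ℕ => ∫ t in (-π)..π,
      (A k * cos ((k + 1 : ℕ) * t) + B k * sin ((k + 1 : ℕ) * t)) * w t)
      (∫ t in (-π)..π, (∑' k, (A k * cos ((k + 1 : ℕ) * t) + B k * sin ((k + 1 : ℕ) * t))) * w t) := by
    refine intervalIntegral.hasSum_integral_of_dominated_convergence
      (fun k _ => |A k| + |B k|) (fun k => Continuous.aestronglyMeasurable (by fun_prop)) ?_ ?_ ?_ ?_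
    · exact fun k => Filter.Eventually.of_forall fun t _ => hterm k t
    · exact Filter.Eventually.of_forall fun t _ => hA.add hB
    · simp
    · exact Filter.Eventually.of_forall fun t _ =>
        (summable_trig hA hB (fun k => ((k + 1 : ℕ) : ℝ)) t).hasSum.mul_right (w t)
  have hc : Continuous fun t =>
      (∑' k, (A k * cos ((k + 1 : ℕ) * t) + B k * sin ((k + 1 : ℕ) * t))) * w t := by
    refine Continuous.mul (continuous_tsum (u := fun k => |A k| + |B k|) (fun k => by fun_prop)
      (hA.add hB) fun k t => ?_) hw
    refine (abs_add_le _ _).trans ?_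
    rw [abs_mul, abs_mul]
    exact add_le_add (mul_le_of_le_one_right (abs_nonneg _) (abs_cos_le_one _))
      (mul_le_of_le_one_right (abs_nonneg _) (abs_sin_le_one _))
  simp_rw [add_mul (a / 2)]
  rw [intervalIntegral.integral_add (Continuous.intervalIntegrable (by fun_prop) _ _)
    (hc.intervalIntegrable _ _), intervalIntegral.integral_const_mul, ← h1.tsum_eq]
  congr 1
  refine tsum_congr fun k => ?_
  simp_rw [add_mul, mul_assoc]
  rw [intervalIntegral.integral_add (Continuous.intervalIntegrable (by fun_prop) _ _)
    (Continuous.intervalIntegrable (by fun_prop) _ _), intervalIntegral.integral_const_mul,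
    intervalIntegral.integral_const_mul]

theorem sum_Icc_one_eq_sum_range (g : ℕ → ℝ) (m : ℕ) :
    ∑ k ∈ Finset.Icc 1 m, g k = ∑ k ∈ Finset.range m, g (k + 1) := by
  induction m with
  | zero => simp
  | succ m ih => rw [Finset.sum_Icc_succ_top (by omega), ih, Finset.sum_range_succ]

/-- The remainder of an absolutely convergent trigonometric series. -/
theorem trigSeries_sub_fourierSum {A B : ℕ → ℝ} (hA : Summable fun k => |A k|)
    (hB : Summable fun k => |B k|) (a : ℝ) {f : ℝ → ℝ}
    (hf : ∀ x, f x = a / 2 + ∑' k, (A k * cos ((k + 1 : ℕ) * x) + B k * sin ((k + 1 : ℕ) * x)))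
    (m : ℕ) (x : ℝ) : f x - fourierSum m f x =
      ∑' k, (A (k + m) * cos ((k + m + 1 : ℕ) * x) + B (k + m) * sin ((k + m + 1 : ℕ) * x)) := by
  have hint := fun w hw hw1 => integral_trigSeries_mul hA hB a (w := w) hw hw1
  simp_rw [← hf] at hint
  have h0 : cosCoeff f 0 = a := by
    have := hint (fun t => cos ((0 : ℕ) * t)) (by fun_prop) fun t => abs_cos_le_one _
    rw [cosCoeff, this]
    simp_rw [integral_cos_mul_cos, integral_sin_mul_cos]
    simp
    field_simp
    ring
  have h1 : ∀ j, cosCoeff f (j + 1) = A j := fun j => by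
    have := hint (fun t => cos ((j + 1 : ℕ) * t)) (by fun_prop) fun t => abs_cos_le_one _
    rw [cosCoeff, this]
    simp_rw [integral_cos_mul_cos, integral_sin_mul_cos]
    have := integral_cos_int_mul ((j + 1 : ℕ) : ℤ)
    rw [if_neg (by omega)] at this
    simp only [Int.cast_natCast] at this
    rw [this, tsum_eq_single j (fun k hk => by rw [if_neg (by omega)]; simp)]
    simp
    field_simp
  have h2 : ∀ j, sinCoeff f (j + 1) = B j := fun j => by
    have := hint (fun t => sin ((j + 1 : ℕ) * t)) (by fun_prop) fun t => abs_sin_le_one _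
    rw [sinCoeff, this]
    simp_rw [mul_comm (cos _) (sin _), integral_sin_mul_sin, integral_sin_mul_cos]
    have := integral_sin_int_mul ((j + 1 : ℕ) : ℤ)
    simp only [Int.cast_natCast] at this
    rw [this, tsum_eq_single j (fun k hk => by rw [if_neg (by omega)]; simp)]
    simp
    field_simp
  have hs := summable_trig hA hB (fun k => ((k + 1 : ℕ) : ℝ)) x
  rw [fourierSum, sum_Icc_one_eq_sum_range, h0, hf]
  simp_rw [h1, h2]
  rw [← hs.sum_add_tsum_nat_add m]
  ring

theorem norm_mul_cos_le (l y : ℝ) : ‖l * cos y‖ ≤ |l| := by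
  rw [norm_mul]; exact mul_le_of_le_one_right (norm_nonneg _) (abs_cos_le_one _)

/-- Convolution of a cosine series with an integrable function. -/
theorem convolution_cosSeries {l : ℕ → ℝ} (hl : Summable fun k => |l k|) (m : ℕ → ℝ) (b : ℝ)
    {φ : ℝ → ℝ} (hφ : Integrable φ periodMeasure) (x : ℝ) :
    ∫ t, (∑' k, l k * cos (m k * (x - t) - b)) * φ t ∂periodMeasure =
      ∑' k, ((l k * ∫ t, cos (m k * t + b) * φ t ∂periodMeasure) * cos (m k * x) +
        (l k * ∫ t, sin (m k * t + b) * φ t ∂periodMeasure) * sin (m k * x)) := by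
  have hicos : ∀ k, Integrable (fun t => cos (m k * t + b) * φ t) periodMeasure := fun k =>
    hφ.bdd_mul (c := 1) (Continuous.aestronglyMeasurable (by fun_prop))
      (Filter.Eventually.of_forall fun t => abs_cos_le_one _)
  have hisin : ∀ k, Integrable (fun t => sin (m k * t + b) * φ t) periodMeasure := fun k =>
    hφ.bdd_mul (c := 1) (Continuous.aestronglyMeasurable (by fun_prop))
      (Filter.Eventually.of_forall fun t => abs_sin_le_one _)
  have hi : ∀ k, Integrable (fun t => l k * cos (m k * (x - t) - b) * φ t) periodMeasure := fun k =>
    hφ.bdd_mul (c := |l k|) (Continuous.aestronglyMeasurable (by fun_prop))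
      (Filter.Eventually.of_forall fun t => norm_mul_cos_le _ _)
  have hsum : Summable fun k => ∫ t, ‖l k * cos (m k * (x - t) - b) * φ t‖ ∂periodMeasure := by
    refine Summable.of_nonneg_of_le (fun k => integral_nonneg fun t => norm_nonneg _) (fun k => ?_)
      (hl.mul_right (∫ t, ‖φ t‖ ∂periodMeasure))
    rw [← integral_const_mul]
    refine integral_mono (hi k).norm (hφ.norm.const_mul _) fun t => ?_
    simp only [norm_mul (l k * _)]
    gcongr
    exact norm_mul_cos_le _ _
  have h := integral_tsum_of_summable_integral_norm hi hsum
  simp_rw [tsum_mul_right] at h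
  rw [← h]
  refine tsum_congr fun k => ?_
  have e : ∀ t, l k * cos (m k * (x - t) - b) * φ t =
      (l k * cos (m k * x)) * (cos (m k * t + b) * φ t) +
        (l k * sin (m k * x)) * (sin (m k * t + b) * φ t) := fun t => by
    rw [show m k * (x - t) - b = m k * x - (m k * t + b) by ring, cos_sub]
    ring
  simp_rw [e]
  rw [integral_add ((hicos k).const_mul _) ((hisin k).const_mul _), integral_const_mul,
    integral_const_mul]
  ring

/-! ### The remainder as a convolution, and the upper bound. -/

/-- The kernel of the remainder operator `f - S_{n-1} (f)`. -/
def tailKernel (α r β : ℝ) (n : ℕ) (t : ℝ) : ℝ :=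
  exp (-α * (n : ℝ) ^ r) / π *
    modulated n (boundarySeries (tailCoeff α r n)) (-(β * π / 2)) t

theorem summable_boundarySeries {l : ℕ → ℝ} (hl : Summable l) (hl0 : ∀ k, 0 ≤ l k) (t : ℝ) :
    Summable fun k => (l k : ℂ) * Complex.exp (k * t * Complex.I) :=
  Summable.of_norm (by simpa only [norm_boundarySeries_term hl0] using hl)

theorem continuous_boundarySeries {l : ℕ → ℝ} (hl : Summable l) (hl0 : ∀ k, 0 ≤ l k) :
    Continuous (boundarySeries l) :=
  continuous_tsum (fun k => by fun_prop) hl fun k t => (norm_boundarySeries_term hl0 t k).le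

theorem boundarySeries_periodic (l : ℕ → ℝ) : Function.Periodic (boundarySeries l) (2 * π) :=
  fun t => tsum_congr fun k => by
    congr 1
    have := Complex.exp_periodic.nat_mul k (k * t * Complex.I)
    rw [← this]
    congr 1
    push_cast
    ring

theorem tailKernel_eq_tsum {α r : ℝ} (β : ℝ) {n : ℕ} (hs : Summable (tailCoeff α r n)) (t : ℝ) :
    tailKernel α r β n t = 1 / π * ∑' k, exp (-α * ((k + n : ℕ) : ℝ) ^ r) *
      cos (((k + n : ℕ) : ℝ) * t - β * π / 2) := by
  have h1 := summable_boundarySeries hs (fun k => (tailCoeff_pos α r n k).le) t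
  rw [tailKernel, modulated, boundarySeries, ← tsum_mul_left,
    Complex.re_tsum (h1.mul_left _), div_eq_mul_one_div, mul_comm _ (1 / π), mul_assoc,
    ← tsum_mul_left]
  congr 1
  refine tsum_congr fun k => ?_
  rw [mul_left_comm, ← Complex.exp_add, Complex.re_ofReal_mul]
  have e : ((n * t + -(β * π / 2) : ℝ) : ℂ) * Complex.I + k * t * Complex.I =
      (((k + n : ℕ) : ℝ) * t - β * π / 2 : ℝ) * Complex.I := by push_cast; ring
  rw [e, Complex.exp_ofReal_mul_I_re, ← mul_assoc, tailCoeff, ← exp_add]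
  congr 2
  rw [add_comm n k]
  ring

theorem continuous_tailKernel {α r : ℝ} (β : ℝ) {n : ℕ} (hs : Summable (tailCoeff α r n)) :
    Continuous (tailKernel α r β n) :=
  (continuous_modulated n (continuous_boundarySeries hs fun k => (tailCoeff_pos α r n k).le)
    _).const_mul _

theorem tailKernel_periodic (α r β : ℝ) (n : ℕ) :
    Function.Periodic (tailKernel α r β n) (2 * π) := fun t => by
  rw [tailKernel, modulated_periodic n (boundarySeries_periodic _), tailKernel]

theorem poissonKernel_periodic (α r β : ℝ) :
    Function.Periodic (poissonKernel α r β) (2 * π) := fun t => tsum_congr fun k => by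
  rw [← cos_add_nat_mul_two_pi (((k + 1 : ℕ) : ℝ) * t - β * π / 2) (k + 1)]
  congr 2
  ring

theorem integrable_of_mem_unitBall {φ : ℝ → ℝ} (hφ : φ ∈ unitBallZeroMean 1) :
    Integrable φ periodMeasure :=
  memLp_one_iff_integrable.mp ⟨hφ.2.1, hφ.2.2.1.trans_lt ENNReal.one_lt_top⟩

/-- Convolving termwise turns f into an absolutely convergent trigonometric series whose
coefficients can be read off. After the first n - 1 frequencies are deleted, the same termwise
identity reassembles the rest into a convolution with the tail. -/
theorem sub_fourierSum_eq {α r β : ℝ} {n : ℕ} (hn : 1 ≤ n) (hs : Summable (tailCoeff α r n))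
    {f φ : ℝ → ℝ} {a₀ : ℝ} (hφ : φ ∈ unitBallZeroMean 1)
    (hf : ∀ x, f x = a₀ / 2 + 1 / π * ∫ t in (-π)..π, poissonKernel α r β (x - t) * φ t) (x : ℝ) :
    f x - fourierSum (n - 1) f x = ∫ t, tailKernel α r β n (x - t) * φ t ∂periodMeasure := by
  have hi := integrable_of_mem_unitBall hφ
  set b := β * π / 2 with hb
  set C : ℕ → ℝ := fun k => ∫ t, cos ((k : ℝ) * t + b) * φ t ∂periodMeasure with hC
  set S : ℕ → ℝ := fun k => ∫ t, sin ((k : ℝ) * t + b) * φ t ∂periodMeasure with hS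
  set M := ∫ t, ‖φ t‖ ∂periodMeasure with hM
  have hCM : ∀ k, |C k| ≤ M := fun k => by
    change ‖∫ t, cos ((k : ℝ) * t + b) * φ t ∂periodMeasure‖ ≤ M
    refine norm_integral_le_of_norm_le hi.norm (Filter.Eventually.of_forall fun t => ?_)
    simp only [norm_mul]
    exact mul_le_of_le_one_left (norm_nonneg _) (abs_cos_le_one _)
  have hSM : ∀ k, |S k| ≤ M := fun k => by
    change ‖∫ t, sin ((k : ℝ) * t + b) * φ t ∂periodMeasure‖ ≤ M
    refine norm_integral_le_of_norm_le hi.norm (Filter.Eventually.of_forall fun t => ?_)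
    simp only [norm_mul]
    exact mul_le_of_le_one_left (norm_nonneg _) (abs_sin_le_one _)
  set c : ℕ → ℝ := fun k => exp (-α * ((k : ℕ) : ℝ) ^ r) with hc
  have hcn : Summable fun k => c (k + n) := by
    have : (fun k => c (k + n)) = fun k => exp (-α * (n : ℝ) ^ r) * tailCoeff α r n k := by
      funext k
      change exp (-α * ((k + n : ℕ) : ℝ) ^ r) = _
      rw [tailCoeff, ← exp_add, add_comm n k]
      congr 1
      ring
    rw [this]
    exact hs.mul_left _
  have hcs : Summable c := (summable_nat_add_iff n).mp hcn
  have hc1 : Summable fun k => c (k + 1) := (summable_nat_add_iff 1).mpr hcs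
  have habs : ∀ k, |c k| = c k := fun k => abs_of_pos (exp_pos _)
  have hA : Summable fun k => |1 / π * (c (k + 1) * C (k + 1))| := by
    refine Summable.of_nonneg_of_le (fun k => abs_nonneg _) (fun k => ?_)
      ((hc1.mul_right M).mul_left (1 / π))
    rw [abs_mul, abs_mul, habs, abs_of_pos (by positivity)]
    have := (exp_pos (-α * ((k + 1 : ℕ) : ℝ) ^ r)).le
    gcongr
    exact hCM _
  have hB : Summable fun k => |1 / π * (c (k + 1) * S (k + 1))| := by
    refine Summable.of_nonneg_of_le (fun k => abs_nonneg _) (fun k => ?_)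
      ((hc1.mul_right M).mul_left (1 / π))
    rw [abs_mul, abs_mul, habs, abs_of_pos (by positivity)]
    have := (exp_pos (-α * ((k + 1 : ℕ) : ℝ) ^ r)).le
    gcongr
    exact hSM _
  have hf' : ∀ x, f x = a₀ / 2 + ∑' k, (1 / π * (c (k + 1) * C (k + 1)) * cos ((k + 1 : ℕ) * x) +
      1 / π * (c (k + 1) * S (k + 1)) * sin ((k + 1 : ℕ) * x)) := fun x => by
    have hper : Function.Periodic (fun t => poissonKernel α r β (x - t) * φ t) (2 * π) :=
      (periodic_sub_left (poissonKernel_periodic α r β) x).mul hφ.1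
    rw [hf, periodic_intervalIntegral_eq hper]
    have := convolution_cosSeries (l := fun k => c (k + 1)) (by simpa only [habs] using hc1)
      (fun k => ((k + 1 : ℕ) : ℝ)) b hi x
    simp only [poissonKernel]
    rw [this, ← tsum_mul_left]
    congr 1
    refine tsum_congr fun k => ?_
    ring
  rw [trigSeries_sub_fourierSum hA hB a₀ hf' (n - 1) x]
  have e : ∀ k, k + (n - 1) + 1 = k + n := fun k => by omega
  have := convolution_cosSeries (l := fun k => c (k + n)) (by simpa only [habs] using hcn)
      (fun k => ((k + n : ℕ) : ℝ)) b hi x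
  simp_rw [tailKernel_eq_tsum β hs, mul_assoc (1 / π)]
  rw [integral_const_mul, this, ← tsum_mul_left]
  refine tsum_congr fun k => ?_
  rw [e]
  ring

theorem fourierError_le {α r : ℝ} (β : ℝ) {n : ℕ} (hn : 1 ≤ n) (hs : Summable (tailCoeff α r n))
    {s : ℝ≥0∞} (hs1 : 1 ≤ s) :
    fourierError n α r β 1 s ≤ periodNorm (tailKernel α r β n) s := by
  refine iSup₂_le fun f hf => ?_
  obtain ⟨-, a₀, φ, hφ, hfx⟩ := hf
  simp_rw [sub_fourierSum_eq hn hs hφ hfx]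
  exact periodNorm_convolution_le (continuous_tailKernel β hs) (tailKernel_periodic α r β n)
    hφ.2.1 hφ.2.2.1 hs1

/-! ### The lower bound by differences of bumps. -/

/-- The difference of two normalized bumps of width `η`, at `0` and at `h`. -/
def bumpDiff (η h t : ℝ) : ℝ :=
  1 / (2 * η) * ((Set.Ico 0 η).indicator 1 t - (Set.Ico h (h + η)).indicator 1 t)

/-- The `2π`-periodic extension of `bumpDiff` from `[0, 2π)`. -/
def periodicBumpDiff (η h t : ℝ) : ℝ := bumpDiff η h (toIcoMod two_pi_pos 0 t)

theorem measurable_bumpDiff (η h : ℝ) : Measurable (bumpDiff η h) :=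
  ((measurable_one.indicator measurableSet_Ico).sub
    (measurable_one.indicator measurableSet_Ico)).const_mul _

theorem periodicBumpDiff_ae_eq (η h : ℝ) : periodicBumpDiff η h =ᵐ[periodMeasure] bumpDiff η h := by
  filter_upwards [ae_restrict_mem measurableSet_Ico] with t ht
  rw [periodicBumpDiff, (toIcoMod_eq_self two_pi_pos).mpr (by simpa using ht)]

theorem integral_mul_bumpDiff {η h : ℝ} (hh : 0 ≤ h) (hhη : h + η ≤ 2 * π)
    {G : ℝ → ℝ} (hG : Continuous G) :
    ∫ t, G t * bumpDiff η h t ∂periodMeasure =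
      1 / (2 * η) * ((∫ t in Set.Ico 0 η, G t) - ∫ t in Set.Ico h (h + η), G t) := by
  have hsub1 : Set.Ico 0 η ⊆ Set.Ico 0 (2 * π) := Set.Ico_subset_Ico_right (by linarith)
  have hsub2 : Set.Ico h (h + η) ⊆ Set.Ico 0 (2 * π) := Set.Ico_subset_Ico hh hhη
  have hGi : Integrable G periodMeasure :=
    (hG.integrableOn_Icc (a := 0) (b := 2 * π)).mono_set Set.Ico_subset_Icc_self
  have e : ∀ t, G t * bumpDiff η h t = 1 / (2 * η) *
      ((Set.Ico 0 η).indicator G t - (Set.Ico h (h + η)).indicator G t) := fun t => by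
    rw [bumpDiff]
    by_cases h1 : t ∈ Set.Ico 0 η <;> by_cases h2 : t ∈ Set.Ico h (h + η) <;> simp [h1, h2] <;> ring
  simp_rw [e]
  rw [integral_const_mul, integral_sub (hGi.indicator measurableSet_Ico)
    (hGi.indicator measurableSet_Ico), setIntegral_indicator measurableSet_Ico,
    setIntegral_indicator measurableSet_Ico, Set.inter_eq_self_of_subset_right hsub1,
    Set.inter_eq_self_of_subset_right hsub2]

/-- Each bump has mass 1/2 and the signs are opposite. The norm is bounded by the triangle
inequality, so the bumps may overlap. -/
theorem periodicBumpDiff_mem {η h : ℝ} (hη : 0 < η) (hh : 0 ≤ h) (hhη : h + η ≤ 2 * π) :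
    periodicBumpDiff η h ∈ unitBallZeroMean 1 := by
  have hper : Function.Periodic (periodicBumpDiff η h) (2 * π) := fun t => by
    rw [periodicBumpDiff, toIcoMod_add_right, periodicBumpDiff]
  have hae := periodicBumpDiff_ae_eq η h
  refine ⟨hper, (measurable_bumpDiff η h).aestronglyMeasurable.congr hae.symm, ?_, ?_⟩
  · rw [periodNorm, eLpNorm_congr_ae hae, eLpNorm_one_eq_lintegral_enorm]
    have hb : ∀ t, ‖bumpDiff η h t‖ₑ ≤ ENNReal.ofReal (1 / (2 * η)) *
        ((Set.Ico 0 η).indicator 1 t + (Set.Ico h (h + η)).indicator 1 t) := fun t => by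
      rw [bumpDiff, enorm_mul, Real.enorm_of_nonneg (by positivity)]
      gcongr
      refine enorm_sub_le.trans (add_le_add ?_ ?_)
      · by_cases h1 : t ∈ Set.Ico 0 η <;> simp [h1]
      · by_cases h1 : t ∈ Set.Ico h (h + η) <;> simp [h1]
    have m1 : Measurable ((Set.Ico 0 η).indicator (1 : ℝ → ℝ≥0∞)) :=
      measurable_one.indicator measurableSet_Ico
    have m2 : Measurable ((Set.Ico h (h + η)).indicator (1 : ℝ → ℝ≥0∞)) :=
      measurable_one.indicator measurableSet_Ico
    calc ∫⁻ t, ‖bumpDiff η h t‖ₑ ∂periodMeasure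
        ≤ ∫⁻ t, ENNReal.ofReal (1 / (2 * η)) *
          ((Set.Ico 0 η).indicator 1 t + (Set.Ico h (h + η)).indicator 1 t) :=
          (setLIntegral_le_lintegral _ _).trans (lintegral_mono hb)
      _ = 1 := by
          rw [lintegral_const_mul _ (by exact m1.add m2), lintegral_add_left m1,
            lintegral_indicator_one measurableSet_Ico, lintegral_indicator_one measurableSet_Ico,
            Real.volume_Ico, Real.volume_Ico, sub_zero, add_sub_cancel_left,
            ← ENNReal.ofReal_add hη.le hη.le, ← ENNReal.ofReal_mul (by positivity),
            ← ENNReal.ofReal_one]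
          congr 1
          field_simp
          norm_num
  · rw [periodic_intervalIntegral_eq hper, integral_congr_ae hae]
    have := integral_mul_bumpDiff hh hhη (G := fun _ => 1) continuous_const
    simp only [one_mul] at this
    rw [this]
    simp [hη.le]

theorem abs_setIntegral_Ico_sub_le {G : ℝ → ℝ} (hG : Continuous G) {a η ω : ℝ} (hη : 0 < η)
    (hω : ∀ t ∈ Set.Ico a (a + η), |G t - G a| ≤ ω) :
    |(∫ t in Set.Ico a (a + η), G t) - η * G a| ≤ η * ω := by
  have hi : IntegrableOn G (Set.Ico a (a + η)) :=
    (hG.integrableOn_Icc (a := a) (b := a + η)).mono_set Set.Ico_subset_Icc_self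
  have hv : (volume : Measure ℝ).real (Set.Ico a (a + η)) = η := by
    rw [Measure.real, Real.volume_Ico, add_sub_cancel_left, ENNReal.toReal_ofReal hη.le]
  have e : (∫ t in Set.Ico a (a + η), G t) - η * G a = ∫ t in Set.Ico a (a + η), (G t - G a) := by
    rw [integral_sub hi (by simp), setIntegral_const, hv, smul_eq_mul]
  have h := norm_setIntegral_le_of_norm_le_const (f := fun t => G t - G a)
    (measure_Ico_lt_top (μ := volume)) hω
  rw [hv] at h
  rw [e, mul_comm]
  exact h

/-- Convolution with difference of bumps approximates half a difference. -/
theorem exists_unitBall_convolution_approx {P : ℝ → ℝ} (hP : Continuous P)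
    (hp : Function.Periodic P (2 * π)) {h : ℝ} (hh : 0 ≤ h) (hh2 : h < 2 * π) {ω : ℝ} (hω : 0 < ω) :
    ∃ φ ∈ unitBallZeroMean 1, ∀ x,
      |(∫ t, P (x - t) * φ t ∂periodMeasure) - 1 / 2 * (P x - P (x - h))| ≤ ω := by
  obtain ⟨η₀, hη₀, hu⟩ := Metric.uniformContinuous_iff.mp (periodic_uniformContinuous hP hp) ω hω
  -- The width keeps the second bump inside [0, 2π) and the variation of P over each bump below ω.
  set η := min η₀ (2 * π - h) with hηdef
  have hη : 0 < η := lt_min hη₀ (by linarith)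
  have hhη : h + η ≤ 2 * π := by linarith [min_le_right η₀ (2 * π - h)]
  refine ⟨periodicBumpDiff η h, periodicBumpDiff_mem hη hh hhη, fun x => ?_⟩
  have hG : Continuous fun t => P (x - t) := by fun_prop
  have hint : ∫ t, P (x - t) * periodicBumpDiff η h t ∂periodMeasure =
      ∫ t, P (x - t) * bumpDiff η h t ∂periodMeasure := by
    refine integral_congr_ae ?_
    filter_upwards [periodicBumpDiff_ae_eq η h] with t ht
    rw [ht]
  have hclose : ∀ a, ∀ t ∈ Set.Ico a (a + η), |P (x - t) - P (x - a)| ≤ ω := fun a t ht => by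
    refine (hu ?_).le
    rw [Real.dist_eq, abs_lt]
    have := min_le_left η₀ (2 * π - h)
    constructor <;> linarith [ht.1, ht.2]
  have h1 := abs_setIntegral_Ico_sub_le hG (a := 0) hη (hclose 0)
  have h2 := abs_setIntegral_Ico_sub_le hG (a := h) hη (hclose h)
  rw [hint, integral_mul_bumpDiff hh hhη hG]
  rw [zero_add, sub_zero] at h1
  set I₁ := ∫ t in Set.Ico 0 η, P (x - t)
  set I₂ := ∫ t in Set.Ico h (h + η), P (x - t)
  have e : 1 / (2 * η) * (I₁ - I₂) - 1 / 2 * (P x - P (x - h)) =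
      ((I₁ - η * P x) - (I₂ - η * P (x - h))) / (2 * η) := by
    field_simp
    ring
  rw [e, abs_div, abs_of_pos (by positivity : 0 < 2 * η), div_le_iff₀ (by positivity)]
  have := abs_sub (I₁ - η * P x) (I₂ - η * P (x - h))
  linarith

theorem continuous_convolution {P φ : ℝ → ℝ} (hP : Continuous P)
    (hp : Function.Periodic P (2 * π)) (hφ : Integrable φ periodMeasure) :
    Continuous fun x => ∫ t, P (x - t) * φ t ∂periodMeasure := by
  have hb : ∀ t, ‖P t‖ ≤ (periodNorm P ∞).toReal := fun t => by
    rw [← toReal_enorm]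
    exact ENNReal.toReal_mono (periodNorm_ne_top hP ∞) (enorm_le_periodNorm_top hP hp t)
  refine continuous_of_dominated (bound := fun t => (periodNorm P ∞).toReal * ‖φ t‖) (fun x => ?_)
    (fun x => Filter.Eventually.of_forall fun t => ?_) (hφ.norm.const_mul _)
    (Filter.Eventually.of_forall fun t => by fun_prop)
  · have : Continuous fun t => P (x - t) := by fun_prop
    exact this.aestronglyMeasurable.mul hφ.1
  · rw [norm_mul]
    gcongr
    exact hb _

/-- The half-difference corresponds to point masses, which are only limits of admissible φ; hence
the arbitrary slack ω. -/
theorem le_fourierError {α r : ℝ} (β : ℝ) {n : ℕ} (hn : 1 ≤ n) (hs : Summable (tailCoeff α r n))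
    {s : ℝ≥0∞} (hs1 : 1 ≤ s) (hE : fourierError n α r β 1 s ≠ ∞) {h : ℝ} (hh : 0 ≤ h)
    (hh2 : h < 2 * π) :
    (periodNorm (fun x => 1 / 2 * (tailKernel α r β n x - tailKernel α r β n (x - h))) s).toReal ≤
      (fourierError n α r β 1 s).toReal := by
  have hc := continuous_tailKernel β hs
  have hp := tailKernel_periodic α r β n
  refine le_of_forall_pos_le_add fun ω hω => ?_
  -- A uniform error ω/(2π) costs at most ω in every norm considered.
  obtain ⟨φ, hφ, hx⟩ := exists_unitBall_convolution_approx hc hp hh hh2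
    (show 0 < ω / (2 * π) by positivity)
  set f : ℝ → ℝ := fun x => (0 : ℝ) / 2 + 1 / π * ∫ t in (-π)..π, poissonKernel α r β (x - t) * φ t
    with hf
  have hfc : f ∈ poissonClass α r β 1 := by
    refine ⟨fun x => ?_, 0, φ, hφ, fun x => rfl⟩
    simp only [hf]
    congr 2
    refine intervalIntegral.integral_congr fun t _ => ?_
    rw [← poissonKernel_periodic α r β (x - t)]
    congr 2
    ring
  have h1 : periodNorm (fun x => ∫ t, tailKernel α r β n (x - t) * φ t ∂periodMeasure) s ≤
      fourierError n α r β 1 s := by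
    have := le_iSup₂ (f := fun f (_ : f ∈ poissonClass α r β 1) =>
      periodNorm (fun x => f x - fourierSum (n - 1) f x) s) f hfc
    simp_rw [sub_fourierSum_eq hn hs hφ (fun x => rfl : ∀ x, f x = _)] at this
    exact this
  have hconv : Continuous fun x => ∫ t, tailKernel α r β n (x - t) * φ t ∂periodMeasure :=
    continuous_convolution hc hp (integrable_of_mem_unitBall hφ)
  have h2 := periodNorm_toReal_le_add (g := fun x => ∫ t, tailKernel α r β n (x - t) * φ t ∂periodMeasure)
    (h := fun _ => ω / (2 * π))
    (f := fun x => 1 / 2 * (tailKernel α r β n x - tailKernel α r β n (x - h)))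
    hconv continuous_const hs1 fun x => by
      have i1 := hx x
      rw [abs_of_pos (show 0 < ω / (2 * π) by positivity)]
      have i2 := abs_sub_abs_le_abs_sub
        (1 / 2 * (tailKernel α r β n x - tailKernel α r β n (x - h)))
        (∫ t, tailKernel α r β n (x - t) * φ t ∂periodMeasure)
      rw [abs_sub_comm] at i1
      linarith
  have h3 := periodNorm_const_le hs1 (show 0 ≤ ω / (2 * π) by positivity)
  rw [mul_div_cancel₀ _ two_pi_pos.ne'] at h3
  have h4 := ENNReal.toReal_mono hE h1
  linarith

/-! ### Consequences of n ≥ n₀. -/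

theorem threshold_pos {p : ℝ≥0∞} (hp : 1 ≤ p) : 0 < threshold p := by
  unfold threshold
  split_ifs with h1 h2
  · norm_num
  · positivity
  · have : 1 < p.toReal := by
      have := (ENNReal.toReal_lt_toReal ENNReal.one_ne_top h2).mpr (lt_of_le_of_ne hp (Ne.symm h1))
      simpa using this
    have h3 : 0 < (p.toReal - 1) / p.toReal := div_pos (by linarith) (by linarith)
    positivity

theorem threshold_le (p : ℝ≥0∞) : threshold p ≤ 1 / 14 := by
  have h0 : 1 / (3 * π) ^ 3 ≤ 1 / 14 := by
    apply one_div_le_one_div_of_le (by norm_num)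
    have : (9 : ℝ) ^ 3 ≤ (3 * π) ^ 3 := by
      gcongr
      linarith [pi_gt_three]
    linarith
  unfold threshold
  split_ifs with h1 h2
  · exact le_rfl
  · exact h0
  · have : (p.toReal - 1) / p.toReal ≤ 1 := div_le_one_of_le₀ (by linarith) ENNReal.toReal_nonneg
    exact (mul_le_of_le_one_right (by positivity) this).trans h0

theorem one_le_chi {p : ℝ≥0∞} (hp : 1 ≤ p) : 1 ≤ chi p := by
  unfold chi
  split_ifs with h
  · exact le_rfl
  · have := (ENNReal.toReal_le_toReal ENNReal.one_ne_top h).mpr hp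
    simpa using this

/-- What the condition `n₀ ≤ n` provides. -/
theorem of_n₀_le {α r : ℝ} {p : ℝ≥0∞} {n : ℕ} (hr₀ : 0 < r) (hr₁ : r < 1) (hα : 0 < α)
    (hp : 1 ≤ p) (hn : n₀ α r p ≤ n) :
    1 ≤ n ∧ 1 / (α * r) * (1 / (n : ℝ) ^ r) + α * r / (n : ℝ) ^ (1 - r) ≤ 1 / 14 := by
  have hαr : 0 < α * r := mul_pos hα hr₀
  have hchi := one_le_chi hp
  -- The defining set of n₀ must be nonempty: `sInf ∅` would be 0 and carry no information.
  have hlim : Filter.Tendsto (fun n : ℕ => 1 / (α * r) * (1 / (n : ℝ) ^ r) +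
      α * r * chi p / (n : ℝ) ^ (1 - r)) Filter.atTop (nhds 0) := by
    have h1 := (tendsto_rpow_neg_atTop hr₀).comp (tendsto_natCast_atTop_atTop (R := ℝ))
    have h2 := (tendsto_rpow_neg_atTop (sub_pos.mpr hr₁)).comp (tendsto_natCast_atTop_atTop (R := ℝ))
    have h3 := (h1.const_mul (1 / (α * r))).add (h2.const_mul (α * r * chi p))
    simp only [mul_zero, add_zero] at h3
    refine h3.congr fun n => ?_
    simp only [Function.comp]
    rw [rpow_neg (Nat.cast_nonneg n), rpow_neg (Nat.cast_nonneg n), one_div ((n : ℝ) ^ r),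
      div_eq_mul_inv (α * r * chi p)]
  have hne : {n : ℕ | 1 ≤ n ∧ 1 / (α * r) * (1 / (n : ℝ) ^ r) +
      α * r * chi p / (n : ℝ) ^ (1 - r) ≤ threshold p}.Nonempty :=
    ((Filter.eventually_ge_atTop 1).and (hlim.eventually_le_const (threshold_pos hp))).exists
  obtain ⟨h1, h2⟩ := Nat.sInf_mem hne
  change 1 ≤ n₀ α r p at h1
  have hpos : (0 : ℝ) < n₀ α r p := by exact_mod_cast h1
  have hle : ((n₀ α r p : ℕ) : ℝ) ≤ n := by exact_mod_cast hn
  refine ⟨h1.trans hn, ?_⟩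
  have h3 := h2.trans (threshold_le p)
  refine le_trans ?_ h3
  change _ ≤ 1 / (α * r) * (1 / (n₀ α r p : ℝ) ^ r) + α * r * chi p / (n₀ α r p : ℝ) ^ (1 - r)
  -- Dropping χ ≥ 1 and increasing n both lower the left-hand side.
  have hnum : α * r ≤ α * r * chi p := le_mul_of_one_le_right hαr.le hchi
  have hr₁' : 0 ≤ 1 - r := by linarith
  gcongr

/-! ### Asymptotics of the error through the geometric kernel. -/

/-- The identity 1/n = δε: a shift of order 1/n is an ε-fraction of the width δ of the peak of u. -/
theorem one_div_eq_decay_mul {α r : ℝ} {n : ℕ} (hr₀ : 0 < r) (hα : 0 < α) (hn : 1 ≤ n) :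
    1 / (n : ℝ) = α * r / (n : ℝ) ^ (1 - r) * (1 / (α * r) * (1 / (n : ℝ) ^ r)) := by
  have hn' : (0 : ℝ) < n := by exact_mod_cast hn
  have e1 : (n : ℝ) = (n : ℝ) ^ (1 - r) * (n : ℝ) ^ r := by
    rw [← rpow_add hn']; simp
  conv_lhs => rw [e1]
  field_simp

/-- Turns the δ part of the relative error of F into an absolute constant. -/
theorem mul_norm_geomKernel_le {δ : ℝ} (hδ : 0 < δ) (hδ1 : δ ≤ 1) (t : ℝ) :
    δ * ‖geomKernel (exp (-δ)) t‖ ≤ 2 := by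
  have hqδ := half_le_one_sub_exp_neg hδ hδ1
  have i1 := norm_geomKernel_le (exp_pos (-δ)).le (by simpa using hδ) t
  have i2 : 1 / (1 - exp (-δ)) ≤ 2 / δ := by
    rw [div_le_div_iff₀ (by linarith) hδ]
    linarith
  calc δ * ‖geomKernel (exp (-δ)) t‖ ≤ δ * (2 / δ) := by gcongr; exact i1.trans i2
    _ = 2 := by field_simp

theorem norm_geomKernel_shift_le {δ ε : ℝ} (hδ : 0 < δ) (hδ1 : δ ≤ 1) {c : ℝ} {t h : ℝ}
    (hh : |h| ≤ c * (δ * ε)) : ‖geomKernel (exp (-δ)) (t + h) - geomKernel (exp (-δ)) t‖ ≤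
      2 * c * ε * ‖geomKernel (exp (-δ)) t‖ := by
  have hqδ := half_le_one_sub_exp_neg hδ hδ1
  refine (norm_geomKernel_add_sub_le (exp_pos (-δ)).le (by simpa using hδ) t h).trans
    (mul_le_mul_of_nonneg_right ?_ (norm_nonneg _))
  rw [div_le_iff₀ (by linarith)]
  have hc0 : 0 ≤ c * ε := by
    refine nonneg_of_mul_nonneg_right (b := c * ε) (a := δ) ?_ hδ
    have := (abs_nonneg h).trans hh
    linarith
  have := mul_le_mul_of_nonneg_left hqδ hc0
  linarith

/-- The relative error (1-q)∑l_k - 1 is at most δ + 1/(1-2ε) - 1 ≤ δ + 3ε, and δ|u| ≤ 2. -/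
theorem norm_tailSeries_sub_le {α r : ℝ} {n : ℕ} (hr₀ : 0 < r) (hr₁ : r < 1) (hα : 0 < α)
    (hn : 1 ≤ n) {δ ε : ℝ} (hδ : 0 < δ) (hε : 0 < ε) (hδdef : δ = α * r / (n : ℝ) ^ (1 - r))
    (hεdef : ε = 1 / (α * r) * (1 / (n : ℝ) ^ r)) (hsmall : ε + δ ≤ 1 / 14) (t : ℝ) :
    ‖boundarySeries (tailCoeff α r n) t - geomKernel (exp (-δ)) t‖ ≤
      3 * ε * ‖geomKernel (exp (-δ)) t‖ + 2 := by
  have hδ1 : α * r / (n : ℝ) ^ (1 - r) ≤ 1 := by rw [← hδdef]; linarith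
  have hε1 : 1 / (α * r) * (1 / (n : ℝ) ^ r) < 1 / 2 := by rw [← hεdef]; linarith
  have hsum := summable_tailCoeff hr₀ hr₁ hα hn hδ1 hε1
  have htsum := tsum_tailCoeff_le hr₀ hr₁ hα hn hδ1 hε1
  rw [← hδdef, ← hεdef] at htsum
  have hqδ : 1 - exp (-δ) ≤ δ := by linarith [add_one_le_exp (-δ)]
  have hκ : (1 - exp (-δ)) * ∑' k, tailCoeff α r n k - 1 ≤ δ + 3 * ε := by
    have h2ε : 0 < 1 - 2 * ε := by linarith
    have i0 : 0 ≤ ∑' k, tailCoeff α r n k := tsum_nonneg fun k => (tailCoeff_pos α r n k).le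
    have i1 : (1 - exp (-δ)) * ∑' k, tailCoeff α r n k ≤ δ * (1 + 1 / (δ * (1 - 2 * ε))) := by
      gcongr
    have i2 : δ * (1 + 1 / (δ * (1 - 2 * ε))) = δ + 1 / (1 - 2 * ε) := by field_simp
    have i3 : 1 / (1 - 2 * ε) ≤ 1 + 3 * ε := by
      rw [div_le_iff₀ h2ε]
      nlinarith
    linarith
  have i1 := norm_boundarySeries_sub_le hsum (fun k => (tailCoeff_pos α r n k).le)
    (tailCoeff_zero α r n) (exp_pos (-δ)).le (by simpa using hδ)
    (fun k => by rw [hδdef]; exact exp_neg_mul_tailCoeff_le hr₀ hr₁ hα hn k) t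
  have i2 := mul_le_mul_of_nonneg_right hκ (norm_nonneg (geomKernel (exp (-δ)) t))
  have i3 := mul_norm_geomKernel_le hδ (by linarith) t
  linarith

/-- Half the difference of a modulated function and its translate by half a period of the
modulation is close to the function itself. -/
theorem abs_modulated_sub_half_diff_le {n : ℕ} (hn : 1 ≤ n) {F u : ℝ → ℂ} {ε : ℝ} (hε : 0 ≤ ε)
    (hε1 : ε ≤ 1 / 14) (hFu : ∀ t, ‖F t - u t‖ ≤ 3 * ε * ‖u t‖ + 2)
    (hu : ∀ x, ‖u (x - π / n) - u x‖ ≤ 2 * π * ε * ‖u x‖) (b x : ℝ) :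
    |modulated n u b x - 1 / 2 * (modulated n F b x - modulated n F b (x - π / n))| ≤
      8 * ε * ‖u x‖ + 2 := by
  have hn' : (0 : ℝ) < n := by exact_mod_cast hn
  -- The shift by π/n changes the carrier phase by π, hence its sign.
  have e1 : modulated n F b (x - π / n) = -modulated n (fun y => F (y - π / n)) b x := by
    rw [modulated_eq, modulated_eq, ← mul_neg, ← cos_sub_pi]
    congr 2
    field_simp
    ring
  have e2 : modulated n u b x - 1 / 2 * (modulated n F b x - modulated n F b (x - π / n)) =
      modulated n (fun y => (1 / 2 : ℝ) * ((u y - F y) + (u (y - π / n) - F (y - π / n)) -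
        (u (y - π / n) - u y))) b x := by
    rw [e1]
    simp only [modulated]
    rw [sub_neg_eq_add, ← Complex.add_re, ← mul_add, ← Complex.re_ofReal_mul, ← Complex.sub_re]
    congr 1
    push_cast
    ring
  rw [e2]
  refine (abs_modulated_le _ _ _ _).trans ?_
  have j1 := hFu x
  have j2 := hFu (x - π / n)
  have j3 := hu x
  have j4 : ‖u (x - π / n)‖ ≤ 2 * ‖u x‖ := by
    have i1 := norm_le_norm_add_norm_sub' (u (x - π / n)) (u x)
    have k1 : 2 * π * ε ≤ 1 := by nlinarith [pi_lt_d2, pi_pos]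
    have := mul_le_mul_of_nonneg_right k1 (norm_nonneg (u x))
    linarith
  have j5 : ‖(u x - F x) + (u (x - π / n) - F (x - π / n)) - (u (x - π / n) - u x)‖ ≤
      ‖F x - u x‖ + ‖F (x - π / n) - u (x - π / n)‖ + ‖u (x - π / n) - u x‖ := by
    rw [norm_sub_rev (F x), norm_sub_rev (F (x - π / n))]
    exact (norm_sub_le _ _).trans (add_le_add (norm_add_le _ _) le_rfl)
  rw [norm_mul, Complex.norm_real, Real.norm_of_nonneg (by norm_num : (0 : ℝ) ≤ 1 / 2)]
  have j6 : 0 ≤ ε * ‖u x‖ := by positivity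
  have j7 := mul_le_mul_of_nonneg_left j4 hε
  -- Half of 3ε|u| + 2, 6ε|u| + 2 and 2πε|u| adds up to (9/2 + π)ε|u| + 2, and π ≤ 7/2 gives the 8.
  have j8 : π * (ε * ‖u x‖) ≤ 7 / 2 * (ε * ‖u x‖) := by
    gcongr
    linarith [pi_lt_d2]
  linarith

/-- Asymptotics of the error of approximation in terms of the norm of the geometric kernel. -/
theorem abs_fourierError_sub_le {α r : ℝ} {n : ℕ} (hr₀ : 0 < r) (hr₁ : r < 1) (hα : 0 < α)
    (hn : 1 ≤ n) (β : ℝ) {δ ε : ℝ} (hδdef : δ = α * r / (n : ℝ) ^ (1 - r))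
    (hεdef : ε = 1 / (α * r) * (1 / (n : ℝ) ^ r)) (hsmall : ε + δ ≤ 1 / 14) {s : ℝ≥0∞}
    (hs : 1 ≤ s) :
    fourierError n α r β 1 s ≠ ∞ ∧
    |(fourierError n α r β 1 s).toReal - exp (-α * (n : ℝ) ^ r) / π *
      ((periodNorm cos s).toReal / (2 * π) ^ (1 / s).toReal *
        (periodNorm (fun t => ‖geomKernel (exp (-δ)) t‖) s).toReal)| ≤
      exp (-α * (n : ℝ) ^ r) / π *
        (21 * ε * (periodNorm (fun t => ‖geomKernel (exp (-δ)) t‖) s).toReal + 4 * π) := by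
  have hn1 : (1 : ℝ) ≤ n := by exact_mod_cast hn
  have hn' : (0 : ℝ) < n := by exact_mod_cast hn
  have hδ : 0 < δ := by rw [hδdef]; positivity
  have hε : 0 < ε := by rw [hεdef]; positivity
  have hnδε : 1 / (n : ℝ) = δ * ε := by
    rw [hδdef, hεdef]; exact one_div_eq_decay_mul hr₀ hα hn
  have hδ1 : δ ≤ 1 := by linarith
  have hsum := summable_tailCoeff hr₀ hr₁ hα hn (by rw [← hδdef]; linarith)
    (by rw [← hεdef]; linarith)
  have hq1 : exp (-δ) < 1 := by simpa using hδ
  have hFu := norm_tailSeries_sub_le hr₀ hr₁ hα hn hδ hε hδdef hεdef hsmall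
  have hshift : ∀ t h c : ℝ, |h| ≤ c / n → ‖geomKernel (exp (-δ)) (t + h) - geomKernel (exp (-δ)) t‖ ≤
      2 * c * ε * ‖geomKernel (exp (-δ)) t‖ := fun t h c hh =>
    norm_geomKernel_shift_le hδ hδ1 (by rwa [div_eq_mul_one_div, hnδε] at hh)
  set u := geomKernel (exp (-δ)) with hu
  have huc : Continuous u := continuous_geomKernel (exp_pos _).le hq1
  have hup : Function.Periodic u (2 * π) := geomKernel_periodic _
  set F := boundarySeries (tailCoeff α r n) with hF
  have hFc : Continuous F := continuous_boundarySeries hsum fun k => (tailCoeff_pos α r n k).le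
  set b := -(β * π / 2) with hb
  have havg := abs_periodNorm_modulated_sub_le hn huc hup (a := 4 * π * ε) (by positivity)
    (fun t h h0 h1 => by
      have := hshift t h (2 * π) (by rwa [abs_of_nonneg h0])
      linarith) hs b
  have hmuc := continuous_modulated n huc b
  have hmFc := continuous_modulated n hFc b
  set D : ℝ → ℝ := fun x => 1 / 2 * (modulated n F b x - modulated n F b (x - π / n)) with hD
  have hDc : Continuous D := by fun_prop
  have hDu : ∀ x, |modulated n u b x - D x| ≤ 8 * ε * ‖u x‖ + 2 :=
    abs_modulated_sub_half_diff_le hn hε.le (by linarith) hFu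
      (fun x => hshift x (-(π / n)) π (by rw [abs_neg, abs_of_pos (by positivity)])) b
  have hup1 : (periodNorm (modulated n F b) s).toReal ≤ (periodNorm (modulated n u b) s).toReal +
      (3 * ε * (periodNorm (fun t => ‖u t‖) s).toReal + 2 * π * 2) :=
    periodNorm_toReal_le_of_abs_le hmuc huc.norm hs (by positivity) zero_le_two fun t => by
      have i1 : |modulated n F b t - modulated n u b t| ≤ 3 * ε * ‖u t‖ + 2 := by
        rw [modulated_sub]
        exact (abs_modulated_le _ _ _ _).trans (hFu t)
      rw [abs_norm]
      have := abs_sub_abs_le_abs_sub (modulated n F b t) (modulated n u b t)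
      linarith
  have hlo2 : (periodNorm (modulated n u b) s).toReal ≤ (periodNorm D s).toReal +
      (8 * ε * (periodNorm (fun t => ‖u t‖) s).toReal + 2 * π * 2) :=
    periodNorm_toReal_le_of_abs_le hDc huc.norm hs (by positivity) zero_le_two fun t => by
      rw [abs_norm]
      have := abs_sub_abs_le_abs_sub (modulated n u b t) (D t)
      linarith [hDu t]
  set U := (periodNorm (fun t => ‖u t‖) s).toReal with hU
  have hU0 : 0 ≤ U := ENNReal.toReal_nonneg
  set KU := (periodNorm cos s).toReal / (2 * π) ^ (1 / s).toReal * U with hKU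
  have hEle := fourierError_le β hn hsum hs
  have hKt := periodNorm_ne_top (continuous_tailKernel β hsum) s
  have hE : fourierError n α r β 1 s ≠ ∞ := ne_top_of_le_ne_top hKt hEle
  have hAπ : 0 < exp (-α * (n : ℝ) ^ r) / π := by positivity
  have hmul : ∀ f : ℝ → ℝ, (periodNorm (fun t => exp (-α * (n : ℝ) ^ r) / π * f t) s).toReal =
      exp (-α * (n : ℝ) ^ r) / π * (periodNorm f s).toReal := fun f => by
    rw [periodNorm_const_mul, abs_of_pos hAπ]
  have hup2 : (fourierError n α r β 1 s).toReal ≤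
      exp (-α * (n : ℝ) ^ r) / π * (periodNorm (modulated n F b) s).toReal := by
    rw [← hmul]
    exact ENNReal.toReal_mono hKt hEle
  have hlo1 : exp (-α * (n : ℝ) ^ r) / π * (periodNorm D s).toReal ≤
      (fourierError n α r β 1 s).toReal := by
    have hle := le_fourierError β hn hsum hs hE (h := π / n) (by positivity) (by
      have : π / n ≤ π := div_le_self pi_pos.le hn1
      linarith [pi_pos])
    refine le_trans (le_of_eq ?_) hle
    rw [← hmul]
    congr 2
    funext x
    simp only [hD, tailKernel]
    ring
  set A := exp (-α * (n : ℝ) ^ r) / π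
  rw [abs_le] at havg
  have hεU : 0 ≤ ε * U := by positivity
  have hπ : π * (ε * U) ≤ 3.15 * (ε * U) := mul_le_mul_of_nonneg_right pi_lt_d2.le hεU
  -- The averaging costs 4πε and the half-difference 8ε; 4π + 8 ≤ 21. The upper bound needs only 4π
  -- + 3.
  have l1 : KU - (21 * ε * U + 4 * π) ≤ (periodNorm D s).toReal := by linarith [havg.1]
  have l2 : (periodNorm (modulated n F b) s).toReal ≤ KU + (21 * ε * U + 4 * π) := by
    linarith [havg.2]
  have m1 := mul_le_mul_of_nonneg_left l1 hAπ.le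
  have m2 := mul_le_mul_of_nonneg_left l2 hAπ.le
  refine ⟨hE, ?_⟩
  rw [abs_le]
  constructor <;> linarith

end GenPoisson

end

/-! ### Assembling the asymptotic formula. -/

theorem mainTheorem1 (α r β : ℝ) (s s' : ℝ≥0∞) (n : ℕ)
    (hr₀ : 0 < r) (hr₁ : r < 1) (hα : 0 < α)
    (hs : 1 ≤ s) (hss' : 1 / s + 1 / s' = 1)
    (hn : GenPoisson.n₀ α r s' ≤ n) :
    GenPoisson.fourierError n α r β 1 s ≠ ∞ ∧
    ∃ γ : ℝ, |γ| ≤ (14 * π) ^ 2 ∧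
      (GenPoisson.fourierError n α r β 1 s).toReal =
        exp (-α * (n : ℝ) ^ r) * (n : ℝ) ^ ((1 - r) * (1 / s').toReal) *
          ((GenPoisson.periodNorm cos s).toReal /
              (π ^ (1 + (1 / s).toReal) * (α * r) ^ (1 / s').toReal) *
              GenPoisson.J s (π * (n : ℝ) ^ (1 - r) / (α * r)) +
            γ * (1 / (α * r) ^ (1 + (1 / s').toReal) *
                GenPoisson.J s (π * (n : ℝ) ^ (1 - r) / (α * r)) * (1 / (n : ℝ) ^ r) +
              1 / (n : ℝ) ^ ((1 - r) * (1 / s').toReal))) := by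
  have hs1 : 1 / s ≤ 1 := le_self_add.trans_eq hss'
  have hs1' : 1 / s' ≤ 1 := le_add_self.trans_eq hss'
  have hs' : 1 ≤ s' := by rwa [one_div, ENNReal.inv_le_one] at hs1'
  obtain ⟨hn1, hsmall⟩ := GenPoisson.of_n₀_le hr₀ hr₁ hα hs' hn
  have hn' : (0 : ℝ) < n := by exact_mod_cast hn1
  have hαr : 0 < α * r := mul_pos hα hr₀
  set δ := α * r / (n : ℝ) ^ (1 - r) with hδdef
  set ε := 1 / (α * r) * (1 / (n : ℝ) ^ r) with hεdef
  have hδ : 0 < δ := by positivity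
  have hε : 0 < ε := by positivity
  obtain ⟨hE, hmain⟩ := GenPoisson.abs_fourierError_sub_le hr₀ hr₁ hα hn1 β hδdef hεdef hsmall hs
  refine ⟨hE, ?_⟩
  have hgeom := GenPoisson.abs_periodNorm_geomKernel_sub_le hδ (by linarith) hs
  have hσ : (1 / s).toReal + (1 / s').toReal = 1 := by
    rw [← ENNReal.toReal_add (ne_top_of_le_ne_top ENNReal.one_ne_top hs1)
      (ne_top_of_le_ne_top ENNReal.one_ne_top hs1'), hss', ENNReal.toReal_one]
  have hJarg : π * (n : ℝ) ^ (1 - r) / (α * r) = π / δ := by rw [hδdef]; field_simp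
  rw [hJarg]
  have hσ0 : 0 ≤ (1 / s).toReal := ENNReal.toReal_nonneg
  have hσ0' : 0 ≤ (1 / s').toReal := ENNReal.toReal_nonneg
  set σ := (1 / s).toReal with hσdef
  set σ' := (1 / s').toReal with hσdef'
  set E := (GenPoisson.fourierError n α r β 1 s).toReal
  set A := exp (-α * (n : ℝ) ^ r)
  have hA : 0 < A := exp_pos _
  set U := (GenPoisson.periodNorm (fun t => ‖GenPoisson.geomKernel (exp (-δ)) t‖) s).toReal
  set c := (GenPoisson.periodNorm cos s).toReal with hc
  have hc0 : 0 ≤ c := ENNReal.toReal_nonneg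
  have hc2 : c ≤ 2 * π := by
    have h1 := GenPoisson.periodNorm_toReal_le_add (f := cos) (g := fun _ => 1) (h := fun _ => 0)
      continuous_const continuous_const hs (fun t => by simpa using abs_cos_le_one t)
    have h2 := GenPoisson.periodNorm_const_le hs (zero_le_one (α := ℝ))
    have h3 := GenPoisson.periodNorm_const_le hs (le_refl (0 : ℝ))
    linarith
  set j := GenPoisson.J s (π / δ)
  have hj0 : 0 ≤ j := ENNReal.toReal_nonneg
  set M := δ ^ (σ - 1) * j with hM
  have hM0 : 0 ≤ M := by positivity
  have hδpow : δ ^ (σ - 1) = (n : ℝ) ^ ((1 - r) * σ') / (α * r) ^ σ' := by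
    rw [show σ - 1 = -σ' by linarith, rpow_neg hδ.le, hδdef, div_rpow hαr.le (by positivity),
      ← rpow_mul hn'.le, inv_div]
  have h2σ : (2 : ℝ) ^ σ ≤ 2 := by
    calc (2 : ℝ) ^ σ ≤ 2 ^ (1 : ℝ) := rpow_le_rpow_of_exponent_le one_le_two (by linarith)
      _ = 2 := rpow_one 2
  have hK1 : c / (2 * π) ^ σ ≤ 2 * π := by
    refine (div_le_self hc0 ?_).trans hc2
    exact one_le_rpow (by linarith [pi_gt_three]) hσ0
  have hK0 : 0 ≤ c / (2 * π) ^ σ := by positivity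
  -- The 2^σ from the two halves of the period cancels against (2π)^σ, leaving π^(1+σ).
  have hmainterm : c / (2 * π) ^ σ * (2 ^ σ * M) / π = c / π ^ (1 + σ) * M := by
    rw [mul_rpow zero_le_two pi_pos.le, rpow_add pi_pos, rpow_one]
    field_simp
  have hdiff : |E - A * (c / π ^ (1 + σ) * M)| ≤ (14 * π) ^ 2 * (A * (ε * M + 1)) := by
    rw [← hmainterm]
    have i1 : |c / (2 * π) ^ σ * U - c / (2 * π) ^ σ * (2 ^ σ * M)| ≤ 2 * π * (4 * π) := by
      rw [← mul_sub, abs_mul, abs_of_nonneg hK0]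
      gcongr
    have i2 : U ≤ 2 * M + 4 * π := by
      have := (abs_le.mp hgeom).2
      have := mul_le_mul_of_nonneg_right h2σ hM0
      linarith
    -- With U ≤ 2M + 4π and ε ≤ 1/14 the left side is at most 42εM + 10π + 8π² ≤ 42εM + 42π, far
    -- below the right side.
    have i3 : 21 * ε * U + 4 * π + 2 * π * (4 * π) ≤ π * ((14 * π) ^ 2 * (ε * M + 1)) := by
      have k1 : ε * U ≤ 2 * (ε * M) + 4 * π / 14 := by
        have := mul_le_mul_of_nonneg_left i2 hε.le
        have k2 : ε * (4 * π) ≤ 1 / 14 * (4 * π) := by gcongr; linarith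
        linarith
      have k3 : 0 ≤ ε * M := by positivity
      have k4 : 588 * π ≤ π * (14 * π) ^ 2 := by
        have : (42 : ℝ) ^ 2 ≤ (14 * π) ^ 2 := by gcongr; linarith [pi_gt_three]
        nlinarith [pi_pos]
      have k5 : 8 * π ^ 2 ≤ 32 * π := by nlinarith [pi_gt_three, pi_lt_d2]
      have k6 := mul_le_mul_of_nonneg_right k4 k3
      have k7 : 3 * (ε * M) ≤ π * (ε * M) := mul_le_mul_of_nonneg_right pi_gt_three.le k3
      have k8 := pi_pos
      rw [mul_add, mul_add, mul_one, ← mul_assoc π _ (ε * M)]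
      linarith
    calc |E - A * (c / (2 * π) ^ σ * (2 ^ σ * M) / π)|
        ≤ |E - A / π * (c / (2 * π) ^ σ * U)| +
          |A / π * (c / (2 * π) ^ σ * U - c / (2 * π) ^ σ * (2 ^ σ * M))| := by
          refine le_trans (le_of_eq ?_) (abs_add_le _ _)
          congr 1
          ring
      _ ≤ A / π * (21 * ε * U + 4 * π) + A / π * (2 * π * (4 * π)) := by
          rw [abs_mul (A / π), abs_of_pos (show 0 < A / π by positivity)]
          gcongr
      _ = A / π * (21 * ε * U + 4 * π + 2 * π * (4 * π)) := by ring
      _ ≤ A / π * (π * ((14 * π) ^ 2 * (ε * M + 1))) := by gcongr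
      _ = _ := by field_simp
  have hpos : 0 < A * (ε * M + 1) := by positivity
  -- γ is the error divided by its prescribed scale A(εM + 1), which is positive even if M vanishes.
  refine ⟨(E - A * (c / π ^ (1 + σ) * M)) / (A * (ε * M + 1)), ?_, ?_⟩
  · rw [abs_div, abs_of_pos hpos, div_le_iff₀ hpos]
    exact hdiff
  · have e1 : (n : ℝ) ^ ((1 - r) * σ') * (c / (π ^ (1 + σ) * (α * r) ^ σ') * j) =
        c / π ^ (1 + σ) * M := by
      rw [hM, hδpow]
      field_simp
    have e2 : (n : ℝ) ^ ((1 - r) * σ') * (1 / (α * r) ^ (1 + σ') * j * (1 / (n : ℝ) ^ r) +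
        1 / (n : ℝ) ^ ((1 - r) * σ')) = ε * M + 1 := by
      rw [hM, hδpow, hεdef, rpow_add hαr, rpow_one]
      field_simp
    rw [mul_assoc, mul_add, e1, mul_left_comm ((n : ℝ) ^ ((1 - r) * σ')), e2]
    field_simp
    ring
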